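/- Let $\Gamma$ be a discrete group acting by measure preserving transformations on a probability space $(X,\mu)$, let $\pi\colon\Gamma\to O(H)$ be an orthogonal representation on a real Hilbert space $H$ with a countable orthonormal basis $(e_n)_{n\in I}$, and let $b\colon\Gamma\to H$ be a 1-cocycle, i.e. $b(gh)=\pi(g)b(h)+b(g)$ for all $g,h\in\Gamma$. Let $(Z,\nu)=\prod_{n\in I}\bigl(\mathbb R,\tfrac1{\sqrt{2\pi}}e^{-s^2/2}\,ds\bigr)$. For $\xi=\sum_n c_ne_n\in H$ let $\omega(\xi)\in\mathcal U(L^\infty(Z))$ be the unitary $z\mapsto\exp\bigl(\sqrt2\,i\sum_n c_nz_n\bigr)$, where the series $\sum_n c_nz_n$ converges in $L^2(Z,\nu)$. Let $D\subseteq L^\infty(Z)$ be the von Neumann algebra generated by all $\omega(\xi)$, $\xi\in H$, with the trace preserving (Gaussian) action of $\Gamma$ determined by $g\cdot\omega(\xi)=\omega(\pi(g)\xi)$. Let $A=L^\infty(X)$ with the induced action of $\Gamma$, let $\tilde M=(D\bar\otimes A)\rtimes\Gamma$ be the crossed product by the diagonal action, with canonical unitaries $(u_g)_{g\in\Gamma}$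 and canonical trace $\tau_{\tilde M}$, and let $M=(1\otimes A)\rtimes\Gamma\subseteq\tilde M$ (a copy of $A\rtimes\Gamma$). Let $\|y\|_2=\tau_{\tilde M}(y^*y)^{1/2}$, and let $E_M\colon\tilde M\to M$ be the trace preserving conditional expectation, i.e. $E_M(y)$ is the unique element of $M$ with $\tau_{\tilde M}(E_M(y)z)=\tau_{\tilde M}(yz)$ for all $z\in M$. For $t\in\mathbb R$ let $\alpha_t$ be the normal $*$-automorphism of $\tilde M$ that is the identity on $D\bar\otimes A$ and satisfies $\alpha_t(u_g)=(\omega(tb(g))\otimes1)u_g$ for all $g\in\Gamma$. Then for every $t\in\mathbb R$ and every $x\in M$ the number $\tau_{\tilde M}(\alpha_t(x)x^*)$ is real and $$\tau_{\tilde M}(\alpha_t(x)x^*)\ \ge\ \|E_M(\alpha_t(x))\|_2^2 .$$ -/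

import Mathlib

namespace CocycleDeformation

open MeasureTheory ProbabilityTheory Complex
open scoped ENNReal NNReal

set_option linter.unusedSectionVars false

section Gaussian

/-- The measure `ν` on `Z = ℝ^ι`: the product of standard Gaussian measures. -/
noncomputable def gaussMeasure (ι : Type*) : Measure (ι → ℝ) :=
  Measure.infinitePi fun _ : ι => gaussianReal 0 1

instance (ι : Type*) : IsProbabilityMeasure (gaussMeasure ι) := by
  unfold gaussMeasure; infer_instance

variable {ι H : Type*} [NormedAddCommGroup H] [InnerProductSpace ℝ H]

theorem map_coord (i : ι) : (gaussMeasure ι).map (fun z => z i) = gaussianReal 0 1 :=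
  Measure.infinitePi_map_eval _ i

theorem memLp_coord (i : ι) : MemLp (fun z : ι → ℝ => z i) 2 (gaussMeasure ι) := by
  have h : MemLp (id : ℝ → ℝ) 2 ((gaussMeasure ι).map (fun z => z i)) := by
    rw [map_coord]; exact memLp_id_gaussianReal 2
  exact h.comp_of_map (measurable_pi_apply i).aemeasurable

/-- The `i`-th coordinate function `z ↦ z i`, as an element of `L²(Z, ν)`; these are orthonormal. -/
noncomputable def coord (i : ι) : Lp ℝ 2 (gaussMeasure ι) := (memLp_coord i).toLp _

theorem coord_ae (i : ι) : coord i =ᵐ[gaussMeasure ι] fun z => z i := MemLp.coeFn_toLp _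

theorem iIndepFun_coord : iIndepFun (fun (i : ι) (z : ι → ℝ) => z i) (gaussMeasure ι) :=
  iIndepFun_infinitePi (X := fun _ x => x) (fun _ => measurable_id)

theorem orthonormal_coord : Orthonormal ℝ (coord : ι → Lp ℝ 2 (gaussMeasure ι)) := by
  classical
  rw [orthonormal_iff_ite]
  intro i j
  have h1 : inner ℝ (coord i) (coord j) = ∫ z, z i * z j ∂(gaussMeasure ι) := by
    rw [L2.inner_def]
    refine integral_congr_ae ?_
    filter_upwards [coord_ae i, coord_ae j] with z hi hj
    simp [hi, hj, mul_comm]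
  have hm : ∀ i : ι, ∫ z, z i ∂(gaussMeasure ι) = 0 := fun i => by
    have := integral_map (μ := gaussMeasure ι) (φ := fun z => z i) (f := fun x : ℝ => x)
      (measurable_pi_apply i).aemeasurable (by fun_prop)
    rw [← this, map_coord]; exact integral_id_gaussianReal
  rw [h1]
  split_ifs with hij
  · subst hij
    have := integral_map (μ := gaussMeasure ι) (φ := fun z => z i) (f := fun x : ℝ => x * x)
      (measurable_pi_apply i).aemeasurable (by fun_prop)
    rw [← this, map_coord]
    have hv := variance_eq_sub (X := id) (μ := gaussianReal 0 1) (memLp_id_gaussianReal 2)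
    rw [variance_id_gaussianReal] at hv
    simp [integral_id_gaussianReal, pow_two] at hv
    exact hv.symm
  · have := (iIndepFun_coord.indepFun hij).integral_fun_mul_eq_mul_integral
      (measurable_pi_apply i).aestronglyMeasurable (measurable_pi_apply j).aestronglyMeasurable
    rw [this, hm, zero_mul]

/-- The isometric linear map `H → L²(Z, ν; ℝ)` with `∑ cᵢ eᵢ ↦ ∑ cᵢ zᵢ`. On the span of the basis
the sum is finite; a general vector is reached by continuity (the series converges in `L²`). -/
noncomputable def gaussField (e : HilbertBasis ι ℝ H) : H →ₗᵢ[ℝ] Lp ℝ 2 (gaussMeasure ι) :=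
  orthonormal_coord.orthogonalFamily.linearIsometry.comp e.repr.toLinearIsometry

theorem hasSum_gaussField (e : HilbertBasis ι ℝ H) (ξ : H) :
    HasSum (fun i => e.repr ξ i • coord i) (gaussField e ξ) :=
  orthonormal_coord.orthogonalFamily.hasSum_linearIsometry (e.repr ξ)

theorem gaussField_basis (e : HilbertBasis ι ℝ H) (i : ι) : gaussField e (e i) = coord i := by
  classical
  have h1 : e.repr (e i) = lp.single 2 i (1 : ℝ) := by simp [e.repr_self]
  have h2 := orthonormal_coord.orthogonalFamily.linearIsometry_apply_single (i := i) (1 : ℝ)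
  change orthonormal_coord.orthogonalFamily.linearIsometry (e.repr (e i)) = coord i
  rw [h1]
  refine h2.trans ?_
  simp

theorem integral_exp_gaussField (e : HilbertBasis ι ℝ H) (ξ : H) :
    ∫ z, exp (I * (gaussField e ξ z : ℝ)) ∂(gaussMeasure ι) = Real.exp (-‖ξ‖ ^ 2 / 2) := by
  have hb : ∀ f : Lp ℝ 2 (gaussMeasure ι),
      Integrable (fun z => exp (I * (f z : ℝ))) (gaussMeasure ι) := fun f => by
    refine Integrable.of_bound (C := 1) ?_ ?_
    · have := Lp.aestronglyMeasurable f
      have h2 : Continuous fun x : ℝ => exp (I * (x : ℂ)) := by fun_prop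
      exact h2.comp_aestronglyMeasurable this
    · filter_upwards with z
      rw [mul_comm, norm_exp_ofReal_mul_I]
  have hcont : Continuous fun f : Lp ℝ 2 (gaussMeasure ι) =>
      ∫ z, exp (I * (f z : ℝ)) ∂(gaussMeasure ι) := by
    refine LipschitzWith.continuous (K := 1) (LipschitzWith.of_dist_le_mul fun f g => ?_)
    rw [dist_eq_norm, dist_eq_norm, ← integral_sub (hb f) (hb g), NNReal.coe_one, one_mul]
    have hfg : Integrable (f - g : Lp ℝ 2 (gaussMeasure ι)) (gaussMeasure ι) :=
      (Lp.memLp (f - g)).integrable (by norm_num)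
    calc _ ≤ ∫ z, ‖(f - g : Lp ℝ 2 (gaussMeasure ι)) z‖ ∂(gaussMeasure ι) := by
          refine norm_integral_le_of_norm_le hfg.norm ?_
          filter_upwards [Lp.coeFn_sub f g] with z hz
          rw [hz, Pi.sub_apply]
          have : exp (I * (f z : ℝ)) - exp (I * (g z : ℝ))
              = exp ((g z : ℝ) * I) * (exp (I * ((f z - g z : ℝ) : ℂ)) - 1) := by
            rw [mul_sub, ← exp_add]; push_cast; ring_nf
          rw [this, norm_mul, norm_exp_ofReal_mul_I, one_mul]
          exact Real.norm_exp_I_mul_ofReal_sub_one_le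
      _ ≤ ‖f - g‖ := by
          rw [Lp.norm_def, integral_norm_eq_lintegral_enorm hfg.1, ← eLpNorm_one_eq_lintegral_enorm]
          exact ENNReal.toReal_mono (Lp.memLp _).2.ne
            (eLpNorm_le_eLpNorm_of_exponent_le (by norm_num) hfg.1)
  have hfin : ∀ s : Finset ι, ∫ z, exp (I * ((∑ i ∈ s, e.repr ξ i • coord i :
      Lp ℝ 2 (gaussMeasure ι)) z : ℝ)) ∂(gaussMeasure ι)
      = exp (((-(∑ i ∈ s, ‖e.repr ξ i‖ ^ 2) / 2 : ℝ)) : ℂ) := fun s => by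
    have hae : (∑ i ∈ s, e.repr ξ i • coord i : Lp ℝ 2 (gaussMeasure ι))
        =ᵐ[gaussMeasure ι] fun z => ∑ i ∈ s, e.repr ξ i * z i := by
      classical
      induction s using Finset.induction_on with
      | empty =>
        simp only [Finset.sum_empty]
        exact Lp.coeFn_zero ℝ 2 (gaussMeasure ι)
      | insert a s ha ih =>
        rw [Finset.sum_insert ha]
        filter_upwards [Lp.coeFn_add (e.repr ξ a • coord a) (∑ i ∈ s, e.repr ξ i • coord i),
          Lp.coeFn_smul (e.repr ξ a) (coord a : Lp ℝ 2 (gaussMeasure ι)), coord_ae a, ih]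
          with z h1 h2 h3 h4
        rw [h1, Pi.add_apply, h2, Pi.smul_apply, h3, h4, Finset.sum_insert ha, smul_eq_mul]
    have hind : iIndepFun (fun (i : ι) (z : ι → ℝ) => e.repr ξ i * z i) (gaussMeasure ι) :=
      iIndepFun_coord.comp (fun i x => e.repr ξ i * x) (fun i => by fun_prop)
    have hmeas : ∀ i, Measurable fun z : ι → ℝ => e.repr ξ i * z i :=
      fun i => (measurable_pi_apply i).const_mul _
    have hch := congrFun ((hind.restrict s).charFun_map_fun_finsetSum_eq_prod
      (fun i _ => (hmeas i).aemeasurable)) 1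
    rw [charFun_apply_real, integral_map (Finset.measurable_sum s fun i _ => hmeas i).aemeasurable
      (by fun_prop), Finset.prod_apply] at hch
    have hone : ∀ i, charFun ((gaussMeasure ι).map fun z => e.repr ξ i * z i) 1
        = exp (((-(‖e.repr ξ i‖ ^ 2) / 2 : ℝ)) : ℂ) := fun i => by
      have h := charFun_gaussianReal (μ := 0) (v := 1) (e.repr ξ i)
      rw [← map_coord i, charFun_apply_real, integral_map
        (measurable_pi_apply i).aemeasurable (by fun_prop)] at h
      rw [charFun_apply_real, integral_map (hmeas i).aemeasurable (by fun_prop)]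
      have h' : ∀ z : ι → ℝ, exp (((1 : ℝ) : ℂ) * ((e.repr ξ i * z i : ℝ) : ℂ) * I)
          = exp ((e.repr ξ i : ℂ) * (z i : ℂ) * I) := fun z => by push_cast; ring_nf
      simp_rw [h']
      rw [h, Real.norm_eq_abs, sq_abs]
      push_cast
      ring_nf
    simp_rw [hone] at hch
    rw [← exp_sum] at hch
    rw [integral_congr_ae (g := fun z => exp (((1 : ℝ) : ℂ) * ((∑ i ∈ s, e.repr ξ i * z i : ℝ) : ℂ)
      * I)), hch]
    · congr 1
      push_cast
      rw [neg_div, Finset.sum_div, ← Finset.sum_neg_distrib]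
      simp [neg_div]
    · filter_upwards [hae] with z hz
      rw [hz]; push_cast; ring_nf
  have ht1 := (hcont.tendsto (gaussField e ξ)).comp (hasSum_gaussField e ξ)
  have ht2 : HasSum (fun i => ‖e.repr ξ i‖ ^ 2) (‖ξ‖ ^ 2) := by
    have := lp.hasSum_norm (by norm_num) (e.repr ξ)
    simpa using this
  have hc2 : Continuous fun r : ℝ => exp (((-r / 2 : ℝ)) : ℂ) := by fun_prop
  have ht3 := (hc2.tendsto (‖ξ‖ ^ 2)).comp ht2
  refine (tendsto_nhds_unique ht1 (ht3.congr fun s => (hfin s).symm)).trans ?_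
  push_cast
  rfl

theorem map_gaussField (e : HilbertBasis ι ℝ H) {ξ : H} (hξ : ‖ξ‖ = 1) :
    (gaussMeasure ι).map (gaussField e ξ) = gaussianReal 0 1 := by
  have hm := (Lp.aestronglyMeasurable (gaussField e ξ)).aemeasurable
  have : IsProbabilityMeasure ((gaussMeasure ι).map (gaussField e ξ)) :=
    Measure.isProbabilityMeasure_map hm
  refine Measure.ext_of_charFun (funext fun t => ?_)
  rw [charFun_gaussianReal, charFun_apply_real, integral_map hm (by fun_prop)]
  have h := integral_exp_gaussField e (t • ξ)
  rw [integral_congr_ae (g := fun z => exp ((t : ℂ) * (gaussField e ξ z : ℝ) * I))] at h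
  · rw [h, norm_smul, hξ]
    simp
    congr 1; ring_nf
  · rw [map_smul]
    filter_upwards [Lp.coeFn_smul t (gaussField e ξ)] with z hz
    rw [hz]; simp; ring_nf

theorem iIndepFun_gaussField (e : HilbertBasis ι ℝ H) {κ : Type*} {f : κ → H}
    (hf : Orthonormal ℝ f) :
    iIndepFun (fun k => (gaussField e (f k) : (ι → ℝ) → ℝ)) (gaussMeasure ι) := by
  have hm : ∀ ξ, AEMeasurable (gaussField e ξ) (gaussMeasure ι) :=
    fun ξ => (Lp.aestronglyMeasurable (gaussField e ξ)).aemeasurable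
  rw [iIndepFun_iff_finset]
  intro s
  refine (iIndepFun_iff_charFun_pi fun k => hm _).2 fun t => ?_
  have hX : ∀ k : s, charFun ((gaussMeasure ι).map
      (s.restrict (fun k => (gaussField e (f k) : (ι → ℝ) → ℝ)) k)) (t k)
      = exp ((-(t k ^ 2) / 2 : ℝ) : ℂ) := fun k => by
    rw [Finset.restrict, map_gaussField e (hf.norm_eq_one k), charFun_gaussianReal]
    congr 1
    push_cast
    ring
  refine Eq.trans ?_ (Finset.prod_congr rfl fun k _ => (hX k).symm)
  have hm2 : AEMeasurable (fun z => WithLp.toLp 2 fun k : s => (gaussField e (f k) : (ι → ℝ) → ℝ) z)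
      (gaussMeasure ι) :=
    (WithLp.measurable_toLp 2 (s → ℝ)).comp_aemeasurable (aemeasurable_pi_lambda _ fun k => hm _)
  rw [charFun_apply, integral_map hm2 (by fun_prop), ← exp_sum]
  have h := integral_exp_gaussField e (∑ k : s, t k • f k)
  have hae : (gaussField e (∑ k : s, t k • f k) : (ι → ℝ) → ℝ)
      =ᵐ[gaussMeasure ι] fun z => ∑ k : s, t k * gaussField e (f k) z := by
    rw [map_sum]
    simp_rw [map_smul]
    filter_upwards [Lp.coeFn_fun_finsetSum Finset.univ fun k : s => t k • gaussField e (f k),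
      ae_all_iff.2 fun k : s => Lp.coeFn_smul (t k) (gaussField e (f k))] with z h1 h2
    rw [h1]
    exact Finset.sum_congr rfl fun k _ => h2 k
  have hn : ‖∑ k : s, t k • f k‖ ^ 2 = ∑ k : s, t k ^ 2 := by
    have hf' : Orthonormal ℝ fun k : s => f k := hf.comp _ Subtype.val_injective
    rw [← real_inner_self_eq_norm_sq, hf'.inner_sum]
    simp [pow_two]
  rw [hn] at h
  rw [integral_congr_ae (g := fun z => exp (I * (gaussField e (∑ k : s, t k • f k) z : ℝ))), h]
  · rw [ofReal_exp, neg_div, Finset.sum_div, ← Finset.sum_neg_distrib]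
    push_cast
    simp [neg_div]
  · filter_upwards [hae] with z hz
    rw [hz]
    simp [PiLp.inner_apply, mul_comm]

/-- The transformation of `Z` that induces the Gaussian action of an orthogonal operator `V`
on the basis vectors: the `i`-th coordinate of `gaussMap e V z` is the value at `z` of the Gaussian
variable of `V eᵢ`. It preserves `ν`, see `measurePreserving_gaussMap`. -/
noncomputable def gaussMap (e : HilbertBasis ι ℝ H) (V : H ≃ₗᵢ[ℝ] H) (z : ι → ℝ) : ι → ℝ :=
  fun i => gaussField e (V (e i)) z

theorem measurePreserving_gaussMap (e : HilbertBasis ι ℝ H) (V : H ≃ₗᵢ[ℝ] H) :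
    MeasurePreserving (gaussMap e V) (gaussMeasure ι) (gaussMeasure ι) := by
  have ho : Orthonormal ℝ fun i => V (e i) := e.orthonormal.comp_linearIsometryEquiv V
  have hm : ∀ i, Measurable (gaussField e (V (e i)) : (ι → ℝ) → ℝ) :=
    fun i => (Lp.stronglyMeasurable _).measurable
  refine ⟨measurable_pi_lambda _ hm, ?_⟩
  have h := (iIndepFun_gaussField e ho).map_fun_eq_infinitePi_map hm
  simp_rw [map_gaussField e (ho.norm_eq_one _)] at h
  exact h

theorem gaussField_comp_gaussMap (e : HilbertBasis ι ℝ H) (V : H ≃ₗᵢ[ℝ] H) (ξ : H) :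
    (fun z => gaussField e ξ (gaussMap e V z)) =ᵐ[gaussMeasure ι] gaussField e (V ξ) := by
  have hV := measurePreserving_gaussMap e V
  refine (Lp.coeFn_compMeasurePreserving (gaussField e ξ) hV).symm.trans ?_
  suffices h : Lp.compMeasurePreserving (gaussMap e V) hV (gaussField e ξ)
      = gaussField e (V ξ) by rw [h]
  have h1 := (hasSum_gaussField e ξ).mapL
    (Lp.compMeasurePreservingₗᵢ ℝ (gaussMap e V) hV (E := ℝ) (p := 2)).toContinuousLinearMap
  have h2 := (e.hasSum_repr ξ).mapL
    ((gaussField e).toContinuousLinearMap ∘L V.toContinuousLinearEquiv.toContinuousLinearMap)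
  refine h1.unique (h2.congr_fun fun i => ?_)
  have h3 : Lp.compMeasurePreserving (gaussMap e V) hV (coord i) = gaussField e (V (e i)) := by
    apply Lp.ext
    filter_upwards [Lp.coeFn_compMeasurePreserving (coord i) hV,
      hV.quasiMeasurePreserving.ae_eq_comp (coord_ae i)] with z h4 h5
    rw [h4, h5]; rfl
  rw [map_smul, map_smul]
  exact congrArg (e.repr ξ i • ·) h3

theorem gaussMap_mul [Countable ι] (e : HilbertBasis ι ℝ H) (V W : H ≃ₗᵢ[ℝ] H) :
    gaussMap e (V * W) =ᵐ[gaussMeasure ι] gaussMap e W ∘ gaussMap e V := by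
  filter_upwards [ae_all_iff.2 fun i => gaussField_comp_gaussMap e V (W (e i))] with z hz
  funext i
  exact (hz i).symm

theorem gaussMap_one [Countable ι] (e : HilbertBasis ι ℝ H) :
    gaussMap e (1 : H ≃ₗᵢ[ℝ] H) =ᵐ[gaussMeasure ι] id := by
  filter_upwards [ae_all_iff.2 fun i => coord_ae (ι := ι) i] with z hz
  funext i
  change gaussField e (e i) z = z i
  rw [gaussField_basis, hz i]

/-- The function `exp(√2 i ∑ cₙ zₙ)` on `Z`, for `ξ = ∑ cₙ eₙ`. -/
noncomputable def omegaFun (e : HilbertBasis ι ℝ H) (ξ : H) (z : ι → ℝ) : ℂ :=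
  exp ((Real.sqrt 2 : ℂ) * I * (gaussField e ξ z : ℝ))

theorem norm_omegaFun (e : HilbertBasis ι ℝ H) (ξ : H) (z : ι → ℝ) : ‖omegaFun e ξ z‖ = 1 := by
  have : (Real.sqrt 2 : ℂ) * I * (gaussField e ξ z : ℝ)
    = ((Real.sqrt 2 * gaussField e ξ z : ℝ) : ℂ) * I := by push_cast; ring
  rw [omegaFun, this, norm_exp_ofReal_mul_I]

theorem memLp_omegaFun (e : HilbertBasis ι ℝ H) (ξ : H) :
    MemLp (omegaFun e ξ) ∞ (gaussMeasure ι) := by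
  refine memLp_top_of_bound ?_ 1 (Filter.Eventually.of_forall fun z => (norm_omegaFun e ξ z).le)
  have h2 : Continuous fun x : ℝ => exp ((Real.sqrt 2 : ℂ) * I * (x : ℂ)) := by fun_prop
  exact h2.comp_aestronglyMeasurable (Lp.aestronglyMeasurable (gaussField e ξ))

/-- The unitary `ω(ξ)` of `L^∞(Z, ν)`. -/
noncomputable def omega (e : HilbertBasis ι ℝ H) (ξ : H) : Lp ℂ ∞ (gaussMeasure ι) :=
  (memLp_omegaFun e ξ).toLp _

theorem omega_ae (e : HilbertBasis ι ℝ H) (ξ : H) :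
    omega e ξ =ᵐ[gaussMeasure ι] omegaFun e ξ := MemLp.coeFn_toLp _

theorem norm_omega_le (e : HilbertBasis ι ℝ H) (ξ : H) : ‖omega e ξ‖ ≤ 1 := by
  rw [omega, Lp.norm_toLp]
  refine ENNReal.toReal_le_of_le_ofReal zero_le_one ?_
  rw [eLpNorm_exponent_top]
  refine eLpNormEssSup_le_of_ae_bound (Filter.Eventually.of_forall fun z => (norm_omegaFun e ξ z).le)

/-- The transformation `gaussMap e V` induces `ω(ξ) ↦ ω(V ξ)`. -/
theorem omega_comp_gaussMap (e : HilbertBasis ι ℝ H) (V : H ≃ₗᵢ[ℝ] H) (ξ : H) :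
    Lp.compMeasurePreserving (gaussMap e V) (measurePreserving_gaussMap e V) (omega e ξ)
      = omega e (V ξ) := by
  apply Lp.ext
  filter_upwards [Lp.coeFn_compMeasurePreserving (omega e ξ) (measurePreserving_gaussMap e V),
    (measurePreserving_gaussMap e V).quasiMeasurePreserving.ae_eq_comp (omega_ae e ξ),
    omega_ae e (V ξ), gaussField_comp_gaussMap e V ξ] with z h1 h2 h3 h4
  rw [h1, h3, h2, Function.comp_apply, omegaFun, omegaFun, h4]

theorem omegaFun_add (e : HilbertBasis ι ℝ H) (ξ η : H) :
    omegaFun e (ξ + η) =ᵐ[gaussMeasure ι] fun z => omegaFun e ξ z * omegaFun e η z := by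
  filter_upwards [Lp.coeFn_add (gaussField e ξ) (gaussField e η)] with z hz
  simp only [omegaFun, map_add]
  rw [hz, ← exp_add, Pi.add_apply]
  push_cast
  ring_nf

theorem omegaFun_neg (e : HilbertBasis ι ℝ H) (ξ : H) :
    omegaFun e (-ξ) =ᵐ[gaussMeasure ι] fun z => star (omegaFun e ξ z) := by
  filter_upwards [Lp.coeFn_neg (gaussField e ξ)] with z hz
  simp only [omegaFun, map_neg]
  rw [hz, Pi.neg_apply, star_def, ← exp_conj]
  simp

end Gaussian

section Operators

variable {Y : Type*} [MeasurableSpace Y] {m : Measure Y}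

/-- The operator on `L²` of multiplication by an `L^∞` function. -/
noncomputable def mulOp (φ : Lp ℂ ∞ m) : Lp ℂ 2 m →L[ℂ] Lp ℂ 2 m :=
  (ContinuousLinearMap.mul ℂ ℂ).holderL m ∞ 2 2 φ

theorem mulOp_ae (φ : Lp ℂ ∞ m) (f : Lp ℂ 2 m) : mulOp φ f =ᵐ[m] fun y => φ y * f y :=
  (ContinuousLinearMap.mul ℂ ℂ).coeFn_holder (r := 2) φ f

theorem norm_mulOp_le (φ : Lp ℂ ∞ m) : ‖mulOp φ‖ ≤ ‖φ‖ := by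
  refine ContinuousLinearMap.opNorm_le_bound _ (norm_nonneg _) fun f => ?_
  refine ((ContinuousLinearMap.mul ℂ ℂ).norm_holder_apply_apply_le (r := 2) φ f).trans ?_
  simp

theorem mulOp_comm (φ ψ : Lp ℂ ∞ m) : mulOp φ * mulOp ψ = mulOp ψ * mulOp φ := by
  ext1 f
  apply Lp.ext
  change mulOp φ (mulOp ψ f) =ᵐ[m] mulOp ψ (mulOp φ f)
  filter_upwards [mulOp_ae φ (mulOp ψ f), mulOp_ae ψ f, mulOp_ae ψ (mulOp φ f), mulOp_ae φ f]
    with y h1 h2 h3 h4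
  rw [h1, h2, h3, h4]; ring

theorem star_mulOp (φ : Lp ℂ ∞ m) : star (mulOp φ) = mulOp (star φ) := by
  rw [ContinuousLinearMap.star_eq_adjoint, eq_comm, ContinuousLinearMap.eq_adjoint_iff]
  intro f g
  rw [L2.inner_def, L2.inner_def]
  refine integral_congr_ae ?_
  filter_upwards [mulOp_ae (star φ) f, mulOp_ae φ g, Lp.coeFn_star φ] with y h1 h2 h3
  rw [h1, h2, h3]
  simp
  ring

variable {Γ : Type*} [Group Γ]

/-- The unitary representation `U_g f = f ∘ S_g` on `L²(Y, m)` given by measure preserving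
transformations with `S_{gh} = S_h ∘ S_g` almost everywhere. -/
noncomputable def koopman (S : Γ → Y → Y) (hS : ∀ g, MeasurePreserving (S g) m m)
    (h1 : S 1 =ᵐ[m] id) (hmul : ∀ g h, S (g * h) =ᵐ[m] S h ∘ S g) :
    Γ →* (Lp ℂ 2 m ≃ₗᵢ[ℂ] Lp ℂ 2 m) :=
  have key1 : ∀ f : Lp ℂ 2 m, Lp.compMeasurePreserving (S 1) (hS 1) f = f := fun f => by
    apply Lp.ext
    filter_upwards [Lp.coeFn_compMeasurePreserving f (hS 1), h1] with y hy hy1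
    rw [hy, Function.comp_apply, hy1, id]
  have key : ∀ g h (f : Lp ℂ 2 m), Lp.compMeasurePreserving (S (g * h)) (hS (g * h)) f
      = Lp.compMeasurePreserving (S g) (hS g) (Lp.compMeasurePreserving (S h) (hS h) f) :=
    fun g h f => by
      apply Lp.ext
      filter_upwards [Lp.coeFn_compMeasurePreserving f (hS (g * h)), hmul g h,
        Lp.coeFn_compMeasurePreserving (Lp.compMeasurePreserving (S h) (hS h) f) (hS g),
        (hS g).quasiMeasurePreserving.ae_eq_comp (Lp.coeFn_compMeasurePreserving f (hS h))]
        with y hy1 hy2 hy3 hy4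
      rw [hy1, hy3, hy4, Function.comp_apply, hy2]; rfl
  { toFun := fun g =>
      { (Lp.compMeasurePreservingₗᵢ ℂ (S g) (hS g) : Lp ℂ 2 m →ₗᵢ[ℂ] Lp ℂ 2 m) with
        invFun := fun f => Lp.compMeasurePreserving (S g⁻¹) (hS g⁻¹) f
        left_inv := fun f => by
          refine (key g⁻¹ g f).symm.trans ?_
          simp only [inv_mul_cancel, key1]
        right_inv := fun f => by
          refine (key g g⁻¹ f).symm.trans ?_
          simp only [mul_inv_cancel, key1] }
    map_one' := LinearIsometryEquiv.ext fun f => key1 f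
    map_mul' := fun g h => LinearIsometryEquiv.ext fun f => key g h f }

theorem conj_koopman_mulOp (S : Γ → Y → Y) (hS : ∀ g, MeasurePreserving (S g) m m)
    (h1 : S 1 =ᵐ[m] id) (hmul : ∀ g h, S (g * h) =ᵐ[m] S h ∘ S g) (g : Γ) (φ : Lp ℂ ∞ m) :
    (koopman S hS h1 hmul g).conjStarAlgEquiv (mulOp φ) =
      mulOp (Lp.compMeasurePreserving (S g) (hS g) φ) := by
  have key : ∀ f, koopman S hS h1 hmul g (mulOp φ f) =
      mulOp (Lp.compMeasurePreserving (S g) (hS g) φ) (koopman S hS h1 hmul g f) :=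
    fun f => by
      apply Lp.ext
      change Lp.compMeasurePreserving (S g) (hS g) (mulOp φ f) =ᵐ[_] mulOp _
        (Lp.compMeasurePreserving (S g) (hS g) f)
      filter_upwards [Lp.coeFn_compMeasurePreserving (mulOp φ f) (hS g),
        (hS g).quasiMeasurePreserving.ae_eq_comp (mulOp_ae φ f),
        mulOp_ae (Lp.compMeasurePreserving (S g) (hS g) φ)
          (Lp.compMeasurePreserving (S g) (hS g) f),
        Lp.coeFn_compMeasurePreserving φ (hS g), Lp.coeFn_compMeasurePreserving f (hS g)]
        with p h1 h2 h3 h4 h5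
      rw [h1, h2, h3, h4, h5]; rfl
  ext1 f
  rw [LinearIsometryEquiv.conjStarAlgEquiv_apply_apply, key, LinearIsometryEquiv.apply_symm_apply]

end Operators


section Crossed

variable {K : Type*} [NormedAddCommGroup K] [InnerProductSpace ℂ K] [CompleteSpace K]

/-- The von Neumann algebra generated by a set of bounded operators: the double commutant of
the set and its adjoints. -/
noncomputable def generatedVN (S : Set (K →L[ℂ] K)) : VonNeumannAlgebra K where
  toStarSubalgebra := StarSubalgebra.centralizer ℂ (StarSubalgebra.centralizer ℂ S : Set (K →L[ℂ] K))
  centralizer_centralizer' := by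
    change Set.centralizer (Set.centralizer
      (StarSubalgebra.centralizer ℂ (StarSubalgebra.centralizer ℂ S : Set (K →L[ℂ] K)) :
        Set (K →L[ℂ] K))) = _
    rw [StarSubalgebra.coe_centralizer_centralizer, Set.centralizer_centralizer_centralizer]
    exact (StarSubalgebra.coe_centralizer_centralizer ℂ S).symm

theorem mem_generatedVN {S : Set (K →L[ℂ] K)} {x : K →L[ℂ] K} :
    x ∈ generatedVN S ↔ ∀ y, (∀ s ∈ S, s * y = y * s ∧ star s * y = y * star s) →
      y * x = x * y := by
  change x ∈ StarSubalgebra.centralizer ℂ (StarSubalgebra.centralizer ℂ S : Set (K →L[ℂ] K)) ↔ _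
  rw [StarSubalgebra.mem_centralizer_iff]
  constructor
  · intro h y hy
    exact (h y (by rwa [SetLike.mem_coe, StarSubalgebra.mem_centralizer_iff])).1
  · intro h y hy
    have hy' : star y ∈ StarSubalgebra.centralizer ℂ S := star_mem hy
    rw [SetLike.mem_coe, StarSubalgebra.mem_centralizer_iff] at hy
    rw [StarSubalgebra.mem_centralizer_iff] at hy'
    exact ⟨h y hy, h _ hy'⟩

theorem subset_generatedVN (S : Set (K →L[ℂ] K)) : S ⊆ generatedVN S := fun _ hx =>
  mem_generatedVN.2 fun _ hy => ((hy _ hx).1).symm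

theorem generatedVN_le {S : Set (K →L[ℂ] K)} {N : VonNeumannAlgebra K} (h : S ⊆ N) :
    generatedVN S ≤ N := by
  intro x hx
  rw [mem_generatedVN] at hx
  rw [← N.commutant_commutant, VonNeumannAlgebra.mem_commutant_iff]
  intro y hy
  rw [VonNeumannAlgebra.mem_commutant_iff] at hy
  exact hx y fun s hs => ⟨hy s (h hs), hy _ (star_mem (h hs))⟩

variable {Γ : Type*}

/-- The bounded operator on `ℓ²(Γ, K)` given by a bounded family of operators on `K`. -/
noncomputable def diagOp (T : Γ → K →L[ℂ] K) (C : ℝ≥0) (hT : ∀ g, ‖T g‖ ≤ C) :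
    lp (fun _ : Γ => K) 2 →L[ℂ] lp (fun _ : Γ => K) 2 :=
  have hle : ∀ (f : lp (fun _ : Γ => K) 2) g, ‖T g (f g)‖ ^ (2 : ℝ≥0∞).toReal
      ≤ (C : ℝ) ^ 2 * ‖f g‖ ^ (2 : ℝ≥0∞).toReal := fun f g => by
    have := (T g).le_of_opNorm_le (hT g) (f g)
    simp only [ENNReal.toReal_ofNat, Real.rpow_ofNat]
    rw [← mul_pow]
    gcongr
  LinearMap.mkContinuous
    { toFun := fun f => ⟨fun g => T g (f g), memℓp_gen (Summable.of_nonneg_of_le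
        (fun _ => by positivity) (hle f)
        (((lp.memℓp f).summable (by norm_num)).mul_left _))⟩
      map_add' := fun f f' => by ext g; simp; rfl
      map_smul' := fun c f => by ext g; simp }
    C fun f => by
      refine lp.norm_le_of_tsum_le (by norm_num) (by positivity) ?_
      refine (Summable.tsum_le_tsum (hle f) (Summable.of_nonneg_of_le
        (fun _ => by positivity) (hle f)
        (((lp.memℓp f).summable (by norm_num)).mul_left _))
        (((lp.memℓp f).summable (by norm_num)).mul_left _)).trans ?_
      rw [tsum_mul_left, ← lp.norm_rpow_eq_tsum (by norm_num)]
      simp [mul_pow]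

@[simp] theorem diagOp_apply (T : Γ → K →L[ℂ] K) (C : ℝ≥0) (hT : ∀ g, ‖T g‖ ≤ C)
    (f : lp (fun _ : Γ => K) 2) (g : Γ) : diagOp T C hT f g = T g (f g) := rfl

theorem star_diagOp (T : Γ → K →L[ℂ] K) (C : ℝ≥0) (hT : ∀ g, ‖T g‖ ≤ C) :
    star (diagOp T C hT) = diagOp (fun g => star (T g)) C (fun g => by rw [norm_star]; exact hT g) := by
  rw [ContinuousLinearMap.star_eq_adjoint, eq_comm, ContinuousLinearMap.eq_adjoint_iff]
  intro f f'
  rw [lp.inner_eq_tsum, lp.inner_eq_tsum]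
  refine tsum_congr fun g => ?_
  rw [diagOp_apply, diagOp_apply, ContinuousLinearMap.star_eq_adjoint,
    ContinuousLinearMap.adjoint_inner_left]

theorem diagOp_comm {T T' : Γ → K →L[ℂ] K} {C C' : ℝ≥0} (hT : ∀ g, ‖T g‖ ≤ C)
    (hT' : ∀ g, ‖T' g‖ ≤ C') (h : ∀ g, T g * T' g = T' g * T g) :
    diagOp T C hT * diagOp T' C' hT' = diagOp T' C' hT' * diagOp T C hT := by
  ext1 f
  ext1
  funext g
  exact congrArg (fun A : K →L[ℂ] K => A (f g)) (h g)

theorem conj_mem_generatedVN {S : Set (K →L[ℂ] K)} {w x : K →L[ℂ] K} (hw : star w * w = 1)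
    (hw' : w * star w = 1) (hS : ∀ s ∈ S, w * s * star w ∈ generatedVN S)
    (hx : x ∈ generatedVN S) : w * x * star w ∈ generatedVN S := by
  refine mem_generatedVN.2 fun y hy => ?_
  have hcomm : ∀ z ∈ generatedVN S, y * z = z * y := fun z hz => mem_generatedVN.1 hz y hy
  have hflip : ∀ s, w * s * star w ∈ generatedVN S →
      s * (star w * y * w) = (star w * y * w) * s := fun s hs => by
    have h := congrArg (fun a => star w * a * w) (hcomm _ hs)
    have e1 : star w * (y * (w * s * star w)) * w = (star w * y * w) * s * (star w * w) := by
      simp only [mul_assoc]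
    have e2 : star w * ((w * s * star w) * y) * w = (star w * w) * (s * (star w * y * w)) := by
      simp only [mul_assoc]
    simp only [e1, e2, hw, one_mul, mul_one] at h
    exact h.symm
  have h := mem_generatedVN.1 hx (star w * y * w) fun s hs => by
    refine ⟨hflip s (hS s hs), hflip (star s) ?_⟩
    have := star_mem (hS s hs)
    simpa [mul_assoc] using this
  have h2 := congrArg (fun a => w * a * star w) h
  have e1 : w * ((star w * y * w) * x) * star w = (w * star w) * (y * (w * x * star w)) := by
    simp only [mul_assoc]
  have e2 : w * (x * (star w * y * w)) * star w = ((w * x * star w) * y) * (w * star w) := by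
    simp only [mul_assoc]
  simp only [e1, e2, hw', one_mul, mul_one] at h2
  exact h2

/-- The automorphism `x ↦ w x w*` of a von Neumann algebra normalized by the unitary `w`. -/
noncomputable def restrictConj (N : VonNeumannAlgebra K) (w : K →L[ℂ] K) (hw : star w * w = 1)
    (hw' : w * star w = 1) (h : ∀ x ∈ N, w * x * star w ∈ N) (h' : ∀ x ∈ N, star w * x * w ∈ N) :
    N.toStarSubalgebra ≃⋆ₐ[ℂ] N.toStarSubalgebra where
  toFun x := ⟨w * x * star w, h x x.2⟩
  invFun x := ⟨star w * x * w, h' x x.2⟩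
  left_inv x := Subtype.ext <| by
    change star w * (w * x * star w) * w = x
    rw [mul_assoc w, ← mul_assoc, hw, one_mul, mul_assoc, hw, mul_one]
  right_inv x := Subtype.ext <| by
    change w * (star w * x * w) * star w = x
    rw [mul_assoc (star w), ← mul_assoc, hw', one_mul, mul_assoc, hw', mul_one]
  map_mul' x y := Subtype.ext <| by
    change w * (x * y) * star w = (w * x * star w) * (w * y * star w)
    simp only [mul_assoc]
    rw [← mul_assoc (star w) w, hw, one_mul]
  map_add' x y := Subtype.ext <| by
    change w * (x + y) * star w = w * x * star w + w * y * star w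
    rw [mul_add, add_mul]
  map_smul' c x := Subtype.ext <| by
    change w * (c • (x : K →L[ℂ] K)) * star w = c • (w * x * star w)
    rw [mul_smul_comm, smul_mul_assoc]
  map_star' x := Subtype.ext <| by
    change w * star (x : K →L[ℂ] K) * star w = star (w * x * star w)
    rw [star_mul, star_mul, star_star, mul_assoc]

theorem conjStarAlgEquiv_mem_generatedVN {S : Set (K →L[ℂ] K)} {u : K ≃ₗᵢ[ℂ] K}
    {x : K →L[ℂ] K} (hS : ∀ s ∈ S, u.conjStarAlgEquiv s ∈ generatedVN S)
    (hx : x ∈ generatedVN S) : u.conjStarAlgEquiv x ∈ generatedVN S := by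
  let w : K →L[ℂ] K := u.toContinuousLinearEquiv
  have hw : star w = (u.symm.toContinuousLinearEquiv : K →L[ℂ] K) := u.adjoint_eq_symm
  have h : ∀ y, u.conjStarAlgEquiv y = w * y * star w := fun y => by rw [hw]; rfl
  rw [h]
  refine conj_mem_generatedVN ?_ ?_ (fun s hs => h s ▸ hS s hs) hx
  · rw [hw]; ext1 f; exact u.symm_apply_apply f
  · rw [hw]; ext1 f; exact u.apply_symm_apply f

variable [Group Γ]

/-- The unitary `u_h` on `ℓ²(Γ, K)`: `(u_h f)(g) = f(h⁻¹ g)`. -/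
noncomputable def translation (h : Γ) :
    lp (fun _ : Γ => K) 2 →L[ℂ] lp (fun _ : Γ => K) 2 :=
  LinearMap.mkContinuous
    { toFun := fun f => ⟨fun g => f (h⁻¹ * g), memℓp_gen
        (((Equiv.mulLeft h⁻¹).summable_iff).2 ((lp.memℓp f).summable (by norm_num)))⟩
      map_add' := fun f f' => by ext g; simp; rfl
      map_smul' := fun c f => by ext g; simp }
    1 fun f => by
      refine lp.norm_le_of_tsum_le (by norm_num) (by positivity) ?_
      rw [one_mul, lp.norm_rpow_eq_tsum (by norm_num)]
      exact ((Equiv.mulLeft h⁻¹).tsum_eq fun g => ‖f g‖ ^ (2 : ℝ≥0∞).toReal).le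

@[simp] theorem translation_apply (h : Γ) (f : lp (fun _ : Γ => K) 2) (g : Γ) :
    translation h f g = f (h⁻¹ * g) := rfl

/-- The image of `x` in the crossed product by the action `σ_g = Ad (U g)`: it acts on
`ℓ²(Γ, K)` by `(x f)(g) = σ_{g⁻¹}(x) f(g)`. -/
noncomputable def crossedEmb (U : Γ →* (K ≃ₗᵢ[ℂ] K)) (x : K →L[ℂ] K) :
    lp (fun _ : Γ => K) 2 →L[ℂ] lp (fun _ : Γ => K) 2 :=
  diagOp (fun g => (U g⁻¹).conjStarAlgEquiv x) ‖x‖₊ fun g =>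
    ContinuousLinearMap.opNorm_le_bound _ (by positivity) fun f => by
      simpa using x.le_opNorm ((U g⁻¹).symm f)

/-- The crossed product `N ⋊ Γ ⊆ B(ℓ²(Γ, K))` of a von Neumann algebra `N ⊆ B(K)` by the action
`σ_g = Ad (U g)` of `Γ` on `N`, for a unitary representation `U` that normalizes `N`: it is
generated by the copy of `N` and the unitaries `u_h`. -/
noncomputable def crossedProduct (N : VonNeumannAlgebra K) (U : Γ →* (K ≃ₗᵢ[ℂ] K)) :
    VonNeumannAlgebra (lp (fun _ : Γ => K) 2) :=
  generatedVN (crossedEmb U '' N ∪ Set.range translation)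

theorem crossedEmb_mem {N : VonNeumannAlgebra K} {U : Γ →* (K ≃ₗᵢ[ℂ] K)} {x : K →L[ℂ] K}
    (hx : x ∈ N) : crossedEmb U x ∈ crossedProduct N U :=
  subset_generatedVN _ (Or.inl ⟨x, hx, rfl⟩)

theorem translation_mem {N : VonNeumannAlgebra K} {U : Γ →* (K ≃ₗᵢ[ℂ] K)} (h : Γ) :
    translation h ∈ crossedProduct N U :=
  subset_generatedVN _ (Or.inr ⟨h, rfl⟩)

end Crossed


section Deformation

/-- The Hilbert space `ℓ²(Γ, L²(Z × X))` on which `M̃` acts. -/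
abbrev HilbertK (Γ ι : Type*) {X : Type*} [MeasurableSpace X] (μ : Measure X) : Type _ :=
  lp (fun _ : Γ => Lp ℂ 2 ((gaussMeasure ι).prod μ)) 2

variable {Γ X ι H : Type*} [Group Γ] [MeasurableSpace X] [MulAction Γ X] [MeasurableConstSMul Γ X]
  (μ : Measure X) [IsProbabilityMeasure μ] [SMulInvariantMeasure Γ X μ]
  [Countable ι] [NormedAddCommGroup H] [InnerProductSpace ℝ H]
  (e : HilbertBasis ι ℝ H) (π : Γ →* (H ≃ₗᵢ[ℝ] H))

/-- The transformation of `Z × X` inducing the diagonal action of `g`. -/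
noncomputable def diagonalMap (g : Γ) (p : (ι → ℝ) × X) : (ι → ℝ) × X :=
  (gaussMap e (π g) p.1, g⁻¹ • p.2)

theorem measurePreserving_diagonalMap (g : Γ) :
    MeasurePreserving (diagonalMap e π g) ((gaussMeasure ι).prod μ) ((gaussMeasure ι).prod μ) :=
  (measurePreserving_gaussMap e (π g)).prod (measurePreserving_smul g⁻¹ μ)

/-- The Koopman representation of `Γ` on `L²(Z × X)`; conjugation by it is the diagonal action `σ`
of `Γ` on `D ⊗ A`, the Gaussian action on `D` and `(g a)(x) = a(g⁻¹ x)` on `A`.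
See `conj_omegaOp`, `conj_liftX` and `conj_mem_tensorAlgebra`. -/
noncomputable def diagonalRep :
    Γ →* (Lp ℂ 2 ((gaussMeasure ι).prod μ) ≃ₗᵢ[ℂ] Lp ℂ 2 ((gaussMeasure ι).prod μ)) :=
  koopman (diagonalMap e π) (measurePreserving_diagonalMap μ e π)
    (by
      filter_upwards [Measure.quasiMeasurePreserving_fst.ae (gaussMap_one e)] with p hp
      simp [diagonalMap, hp])
    (fun g h => by
      filter_upwards [Measure.quasiMeasurePreserving_fst.ae (gaussMap_mul e (π g) (π h))] with p hp
      simp [diagonalMap, hp, mul_smul])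

/-- The function `φ ⊗ 1`. -/
noncomputable def liftZ (φ : Lp ℂ ∞ (gaussMeasure ι)) : Lp ℂ ∞ ((gaussMeasure ι).prod μ) :=
  Lp.compMeasurePreserving Prod.fst measurePreserving_fst φ

variable (ι) in
/-- The function `1 ⊗ a`. -/
noncomputable def liftX (a : Lp ℂ ∞ μ) : Lp ℂ ∞ ((gaussMeasure ι).prod μ) :=
  Lp.compMeasurePreserving Prod.snd measurePreserving_snd a

/-- The algebra `D ⊆ L^∞(Z)`: the von Neumann algebra generated by the `ω(ξ)`, `ξ ∈ H`, where
`L^∞(Z)` acts on `L²(Z)` by multiplication. -/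
def gaussAlgebra : Set (Lp ℂ ∞ (gaussMeasure ι)) :=
  {φ | mulOp φ ∈ generatedVN (Set.range fun ξ => mulOp (omega e ξ))}

/-- The von Neumann algebra `D ⊗ A` on `L²(Z × X)`, where `A = L^∞(X)`. -/
noncomputable def tensorAlgebra : VonNeumannAlgebra (Lp ℂ 2 ((gaussMeasure ι).prod μ)) :=
  generatedVN ((fun φ => mulOp (liftZ μ φ)) '' gaussAlgebra e ∪
    Set.range fun a => mulOp (liftX ι μ a))

variable (ι) in
/-- The von Neumann algebra `1 ⊗ A` on `L²(Z × X)`, where `A = L^∞(X)`. -/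
noncomputable def oneTensorAlgebra : VonNeumannAlgebra (Lp ℂ 2 ((gaussMeasure ι).prod μ)) :=
  generatedVN (Set.range fun a => mulOp (liftX ι μ a))

/-- The algebra `M̃ = (D ⊗ A) ⋊ Γ`. -/
noncomputable def Mtilde :
    VonNeumannAlgebra (HilbertK Γ ι μ) :=
  crossedProduct (tensorAlgebra μ e) (diagonalRep μ e π)

/-- The algebra `M = A ⋊ Γ`, as the subalgebra `(1 ⊗ A) ⋊ Γ` of `M̃`. -/
noncomputable def Msub :
    VonNeumannAlgebra (HilbertK Γ ι μ) :=
  crossedProduct (oneTensorAlgebra ι μ) (diagonalRep μ e π)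

theorem Msub_le_Mtilde : Msub μ e π ≤ Mtilde μ e π := by
  refine generatedVN_le (Set.Subset.trans ?_ (subset_generatedVN _))
  refine Set.union_subset_union_left _ (Set.image_mono ?_)
  exact generatedVN_le (Set.Subset.trans Set.subset_union_right (subset_generatedVN _))

/-- The operator `ω(ξ) ⊗ 1`. -/
noncomputable def omegaOp (ξ : H) :
    Lp ℂ 2 ((gaussMeasure ι).prod μ) →L[ℂ] Lp ℂ 2 ((gaussMeasure ι).prod μ) :=
  mulOp (liftZ μ (omega e ξ))

theorem liftZ_omega_ae (ξ : H) :
    liftZ μ (omega e ξ) =ᵐ[(gaussMeasure ι).prod μ] fun p => omegaFun e ξ p.1 := by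
  filter_upwards [Lp.coeFn_compMeasurePreserving (omega e ξ)
      (measurePreserving_fst (μ := gaussMeasure ι) (ν := μ)),
    Measure.quasiMeasurePreserving_fst.ae (omega_ae e ξ)] with p h1 h2
  rw [liftZ, h1, Function.comp_apply, h2]

theorem omegaOp_ae (ξ : H) (f : Lp ℂ 2 ((gaussMeasure ι).prod μ)) :
    omegaOp μ e ξ f =ᵐ[(gaussMeasure ι).prod μ] fun p => omegaFun e ξ p.1 * f p := by
  filter_upwards [mulOp_ae (liftZ μ (omega e ξ)) f, liftZ_omega_ae μ e ξ] with p h1 h2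
  rw [omegaOp, h1, h2]

theorem norm_omegaOp_le (ξ : H) : ‖omegaOp μ e ξ‖ ≤ ((1 : ℝ≥0) : ℝ) := by
  refine (norm_mulOp_le _).trans ?_
  rw [liftZ, Lp.norm_compMeasurePreserving]
  exact norm_omega_le e ξ

theorem omegaOp_add (ξ η : H) : omegaOp μ e (ξ + η) = omegaOp μ e ξ * omegaOp μ e η := by
  ext1 f
  apply Lp.ext
  change omegaOp μ e (ξ + η) f =ᵐ[_] omegaOp μ e ξ (omegaOp μ e η f)
  filter_upwards [omegaOp_ae μ e (ξ + η) f, omegaOp_ae μ e ξ (omegaOp μ e η f),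
    omegaOp_ae μ e η f, Measure.quasiMeasurePreserving_fst.ae (omegaFun_add e ξ η)]
    with p h1 h2 h3 h4
  rw [h1, h2, h3, h4]; ring

theorem omegaOp_zero : omegaOp μ e 0 = 1 := by
  ext1 f
  apply Lp.ext
  filter_upwards [omegaOp_ae μ e 0 f,
    Measure.quasiMeasurePreserving_fst.ae (Lp.coeFn_zero ℝ 2 (gaussMeasure ι))] with p h1 h2
  rw [h1]
  simp only [omegaFun, map_zero]
  rw [h2]
  simp

theorem star_omegaOp (ξ : H) : star (omegaOp μ e ξ) = omegaOp μ e (-ξ) := by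
  rw [omegaOp, star_mulOp]
  ext1 f
  apply Lp.ext
  filter_upwards [omegaOp_ae μ e (-ξ) f, mulOp_ae (star (liftZ μ (omega e ξ))) f,
    Lp.coeFn_star (liftZ μ (omega e ξ)), liftZ_omega_ae μ e ξ,
    Measure.quasiMeasurePreserving_fst.ae (omegaFun_neg e ξ)] with p h1 h2 h3 h4 h5
  rw [h1, h2, h3, Pi.star_apply, h4, h5]

theorem conj_mulOp (g : Γ) (φ : Lp ℂ ∞ ((gaussMeasure ι).prod μ)) :
    (diagonalRep μ e π g).conjStarAlgEquiv (mulOp φ) =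
      mulOp (Lp.compMeasurePreserving (diagonalMap e π g)
        (measurePreserving_diagonalMap μ e π g) φ) :=
  conj_koopman_mulOp _ _ _ _ g φ

theorem conj_liftX (g : Γ) (a : Lp ℂ ∞ μ) :
    (diagonalRep μ e π g).conjStarAlgEquiv (mulOp (liftX ι μ a)) =
      mulOp (liftX ι μ (Lp.compMeasurePreserving (g⁻¹ • ·) (measurePreserving_smul g⁻¹ μ) a)) := by
  rw [conj_mulOp]
  congr 1
  rw [liftX, liftX, ← Lp.compMeasurePreserving_comp_apply, ← Lp.compMeasurePreserving_comp_apply]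
  rfl

/-- The Koopman representation of `Γ` on `L²(Z)`; conjugation by it is the Gaussian action. -/
noncomputable def gaussRep : Γ →* (Lp ℂ 2 (gaussMeasure ι) ≃ₗᵢ[ℂ] Lp ℂ 2 (gaussMeasure ι)) :=
  koopman (fun g => gaussMap e (π g)) (fun g => measurePreserving_gaussMap e (π g))
    (by rw [map_one]; exact gaussMap_one e) (fun g h => by rw [map_mul]; exact gaussMap_mul e _ _)

theorem conj_gaussRep_mulOp (g : Γ) (φ : Lp ℂ ∞ (gaussMeasure ι)) :
    (gaussRep e π g).conjStarAlgEquiv (mulOp φ) =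
      mulOp (Lp.compMeasurePreserving (gaussMap e (π g)) (measurePreserving_gaussMap e (π g)) φ) :=
  conj_koopman_mulOp _ _ _ _ g φ

/-- The Gaussian action preserves `D`. -/
theorem gaussAlgebra_comp (g : Γ) {φ : Lp ℂ ∞ (gaussMeasure ι)} (hφ : φ ∈ gaussAlgebra e) :
    Lp.compMeasurePreserving (gaussMap e (π g)) (measurePreserving_gaussMap e (π g)) φ
      ∈ gaussAlgebra e := by
  change mulOp _ ∈ generatedVN _
  rw [← conj_gaussRep_mulOp]
  refine conjStarAlgEquiv_mem_generatedVN ?_ hφ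
  rintro _ ⟨ξ, rfl⟩
  rw [conj_gaussRep_mulOp, omega_comp_gaussMap]
  exact subset_generatedVN _ ⟨_, rfl⟩

/-- The diagonal action preserves `D ⊗ A`. -/
theorem conj_mem_tensorAlgebra (g : Γ)
    {x : Lp ℂ 2 ((gaussMeasure ι).prod μ) →L[ℂ] Lp ℂ 2 ((gaussMeasure ι).prod μ)}
    (hx : x ∈ tensorAlgebra μ e) :
    (diagonalRep μ e π g).conjStarAlgEquiv x ∈ tensorAlgebra μ e := by
  refine conjStarAlgEquiv_mem_generatedVN ?_ hx
  rintro _ (⟨φ, hφ, rfl⟩ | ⟨a, rfl⟩)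
  · refine subset_generatedVN _ (Or.inl ⟨_, gaussAlgebra_comp e π g hφ, ?_⟩)
    change mulOp _ = (diagonalRep μ e π g).conjStarAlgEquiv (mulOp (liftZ μ φ))
    rw [conj_mulOp]
    congr 1
    rw [liftZ, liftZ, ← Lp.compMeasurePreserving_comp_apply,
      ← Lp.compMeasurePreserving_comp_apply]
    rfl
  · change (diagonalRep μ e π g).conjStarAlgEquiv (mulOp (liftX ι μ a)) ∈ _
    rw [conj_liftX]
    exact subset_generatedVN _ (Or.inr ⟨_, rfl⟩)

/-- The diagonal action sends `ω(ξ) ⊗ 1` to `ω(π(g) ξ) ⊗ 1`. -/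
theorem conj_omegaOp (g : Γ) (ξ : H) :
    (diagonalRep μ e π g).conjStarAlgEquiv (omegaOp μ e ξ) = omegaOp μ e (π g ξ) := by
  rw [omegaOp, conj_mulOp, omegaOp]
  congr 1
  apply Lp.ext
  have hS := measurePreserving_diagonalMap μ e π g
  filter_upwards [Lp.coeFn_compMeasurePreserving (liftZ μ (omega e ξ)) hS,
    hS.quasiMeasurePreserving.ae_eq_comp (liftZ_omega_ae μ e ξ), liftZ_omega_ae μ e (π g ξ),
    Measure.quasiMeasurePreserving_fst.ae (gaussField_comp_gaussMap e (π g) ξ)] with p h1 h2 h3 h4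
  rw [h1, h2, h3, Function.comp_apply, omegaFun, omegaFun, ← h4]
  rfl

variable (b : Γ → H)

/-- The unitary on `ℓ²(Γ, L²(Z × X))` that acts on the `g`-th component by
`ω(-t b(g⁻¹)) ⊗ 1`. It implements the deformation `α_t`. -/
noncomputable def deformationUnitary (t : ℝ) :
    HilbertK Γ ι μ →L[ℂ]
      HilbertK Γ ι μ :=
  diagOp (fun g => omegaOp μ e (-(t • b g⁻¹))) 1 fun _ => norm_omegaOp_le μ e _

theorem star_deformationUnitary (t : ℝ) :
    star (deformationUnitary μ e b t) = deformationUnitary μ e b (-t) := by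
  rw [deformationUnitary, star_diagOp]
  ext1 f
  ext1
  funext g
  simp [deformationUnitary, star_omegaOp]

theorem deformationUnitary_mul_neg (t : ℝ) :
    deformationUnitary μ e b t * deformationUnitary μ e b (-t) = 1 := by
  ext1 f
  ext1
  funext g
  change omegaOp μ e (-(t • b g⁻¹)) (omegaOp μ e (-(-t • b g⁻¹)) (f g)) = f g
  rw [← mul_apply_eq_comp, ← omegaOp_add]
  simp [omegaOp_zero]

theorem deformationUnitary_mul_star (t : ℝ) :
    deformationUnitary μ e b t * star (deformationUnitary μ e b t) = 1 := by
  rw [star_deformationUnitary, deformationUnitary_mul_neg]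

theorem star_deformationUnitary_mul (t : ℝ) :
    star (deformationUnitary μ e b t) * deformationUnitary μ e b t = 1 := by
  have := deformationUnitary_mul_neg μ e b (-t)
  rwa [neg_neg, ← star_deformationUnitary] at this

theorem omegaOp_comm (ξ : H)
    {x : Lp ℂ 2 ((gaussMeasure ι).prod μ) →L[ℂ] Lp ℂ 2 ((gaussMeasure ι).prod μ)}
    (hx : x ∈ tensorAlgebra μ e) : omegaOp μ e ξ * x = x * omegaOp μ e ξ := by
  refine mem_generatedVN.1 hx _ ?_
  rintro s (⟨φ, -, rfl⟩ | ⟨a, rfl⟩)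
  · exact ⟨mulOp_comm _ _, by rw [star_mulOp]; exact mulOp_comm _ _⟩
  · exact ⟨mulOp_comm _ _, by rw [star_mulOp]; exact mulOp_comm _ _⟩

theorem deformationUnitary_comm (t : ℝ)
    {x : Lp ℂ 2 ((gaussMeasure ι).prod μ) →L[ℂ] Lp ℂ 2 ((gaussMeasure ι).prod μ)}
    (hx : x ∈ tensorAlgebra μ e) :
    deformationUnitary μ e b t * crossedEmb (diagonalRep μ e π) x =
      crossedEmb (diagonalRep μ e π) x * deformationUnitary μ e b t := by
  refine diagOp_comm _ _ fun g => ?_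
  have h : omegaOp μ e (-(t • b g⁻¹)) = (diagonalRep μ e π g⁻¹).conjStarAlgEquiv
      (omegaOp μ e (π g (-(t • b g⁻¹)))) := by
    rw [conj_omegaOp, map_inv]
    exact congrArg (omegaOp μ e) ((π g).symm_apply_apply _).symm
  rw [h, ← map_mul, ← map_mul, omegaOp_comm μ e _ hx]

/-- `b` is a 1-cocycle for `π`. -/
def IsOneCocycle (π : Γ →* (H ≃ₗᵢ[ℝ] H)) (b : Γ → H) : Prop :=
  ∀ g h, b (g * h) = π g (b h) + b g

variable {b}

theorem omegaOp_mem (ξ : H) : omegaOp μ e ξ ∈ tensorAlgebra μ e :=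
  subset_generatedVN _ (Or.inl ⟨omega e ξ, subset_generatedVN _ ⟨ξ, rfl⟩, rfl⟩)

theorem deformationUnitary_translation (hb : IsOneCocycle π b) (t : ℝ) (h : Γ) :
    deformationUnitary μ e b t * translation h * star (deformationUnitary μ e b t) =
      crossedEmb (diagonalRep μ e π) (omegaOp μ e (t • b h)) * translation h := by
  rw [star_deformationUnitary]
  ext1 f
  ext1
  funext g
  change omegaOp μ e (-(t • b g⁻¹)) (omegaOp μ e (-(-t • b (h⁻¹ * g)⁻¹)) (f (h⁻¹ * g))) =
    (diagonalRep μ e π g⁻¹).conjStarAlgEquiv (omegaOp μ e (t • b h)) (f (h⁻¹ * g))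
  rw [conj_omegaOp, ← mul_apply_eq_comp, ← omegaOp_add, mul_inv_rev, inv_inv, hb, map_smul]
  congr 2
  simp

theorem deformation_mem (hb : IsOneCocycle π b) (t : ℝ)
    {x : HilbertK Γ ι μ →L[ℂ]
      HilbertK Γ ι μ} (hx : x ∈ Mtilde μ e π) :
    deformationUnitary μ e b t * x * star (deformationUnitary μ e b t) ∈ Mtilde μ e π := by
  have h1 := deformationUnitary_mul_star μ e b t
  have h2 := star_deformationUnitary_mul μ e b t
  refine conj_mem_generatedVN h2 h1 ?_ hx
  rintro s (⟨x, hx, rfl⟩ | ⟨h, rfl⟩)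
  · rw [deformationUnitary_comm μ e π b t hx, mul_assoc, h1, mul_one]
    exact subset_generatedVN _ (Or.inl ⟨x, hx, rfl⟩)
  · rw [deformationUnitary_translation μ e π hb]
    exact mul_mem (subset_generatedVN _ (Or.inl ⟨_, omegaOp_mem μ e _, rfl⟩))
      (subset_generatedVN _ (Or.inr ⟨h, rfl⟩))

/-- The automorphism `α_t` of `M̃`. It is normal, being implemented by a unitary, and it is the identity
on `D ⊗ A` and maps `u_h` to `(ω(t b(h)) ⊗ 1) u_h`: see `deformation_crossedEmb` and
`deformation_translation`. These properties determine it, as `D ⊗ A` and the `u_h` generate `M̃`. -/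
noncomputable def deformation (hb : IsOneCocycle π b) (t : ℝ) :
    (Mtilde μ e π).toStarSubalgebra ≃⋆ₐ[ℂ] (Mtilde μ e π).toStarSubalgebra :=
  restrictConj (Mtilde μ e π) (deformationUnitary μ e b t)
    (star_deformationUnitary_mul μ e b t) (deformationUnitary_mul_star μ e b t)
    (fun _ hx => deformation_mem μ e π hb t hx)
    (fun x hx => by
      have h := deformation_mem μ e π hb (-t) hx
      rwa [← star_deformationUnitary, star_star] at h)

theorem deformation_crossedEmb (hb : IsOneCocycle π b) (t : ℝ)
    {x : Lp ℂ 2 ((gaussMeasure ι).prod μ) →L[ℂ] Lp ℂ 2 ((gaussMeasure ι).prod μ)}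
    (hx : x ∈ tensorAlgebra μ e) :
    (deformation μ e π hb t ⟨crossedEmb (diagonalRep μ e π) x, crossedEmb_mem hx⟩ :
      HilbertK Γ ι μ →L[ℂ] HilbertK Γ ι μ) = crossedEmb (diagonalRep μ e π) x := by
  change deformationUnitary μ e b t * _ * star (deformationUnitary μ e b t) = _
  rw [deformationUnitary_comm μ e π b t hx, mul_assoc, deformationUnitary_mul_star, mul_one]

theorem deformation_translation (hb : IsOneCocycle π b) (t : ℝ) (h : Γ) :
    (deformation μ e π hb t ⟨translation h, translation_mem h⟩ : HilbertK Γ ι μ →L[ℂ] HilbertK Γ ι μ) =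
      crossedEmb (diagonalRep μ e π) (omegaOp μ e (t • b h)) * translation h :=
  deformationUnitary_translation μ e π hb t h

variable (Γ ι) in
/-- The vector `1 ⊗ δ_e` of `ℓ²(Γ, L²(Z × X))`. -/
noncomputable def vacuum : HilbertK Γ ι μ := by
  classical exact lp.single 2 1 (Lp.const 2 ((gaussMeasure ι).prod μ) (1 : ℂ))

variable {μ}

/-- The trace of `M̃`: the vector functional of `1 ⊗ δ_e`, so that `τ(x u_h)` is the integral of `x`
when `h = e` and zero otherwise, for `x` in `D ⊗ A`. -/
noncomputable def tau (x : HilbertK Γ ι μ →L[ℂ]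
      HilbertK Γ ι μ) : ℂ :=
  inner ℂ (vacuum Γ ι μ) (x (vacuum Γ ι μ))

/-- The 2-norm `‖x‖₂ = τ(x* x)^{1/2}`. -/
noncomputable def twoNorm (x : HilbertK Γ ι μ →L[ℂ]
      HilbertK Γ ι μ) : ℝ :=
  Real.sqrt (tau (star x * x)).re

/-- `y` is the image of `x` under the `τ`-preserving conditional expectation onto `N`. -/
def IsCondExp (N : VonNeumannAlgebra (HilbertK Γ ι μ))
    (x y : HilbertK Γ ι μ →L[ℂ]
      HilbertK Γ ι μ) : Prop :=
  y ∈ N ∧ ∀ z ∈ N, tau (y * z) = tau (x * z)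

open Classical in
/-- The `τ`-preserving conditional expectation `E_N : M̃ → N` onto a von Neumann subalgebra `N`
of `M̃`: `E_N(x)` is the unique `y ∈ N` with `τ(y z) = τ(x z)` for all `z ∈ N`. For every `x ∈ M̃`
such a `y` exists, as `τ` is a faithful normal trace on `M̃`. -/
noncomputable def condExp
    (N : VonNeumannAlgebra (HilbertK Γ ι μ))
    (x : HilbertK Γ ι μ →L[ℂ]
      HilbertK Γ ι μ) :
    HilbertK Γ ι μ →L[ℂ]
      HilbertK Γ ι μ :=
  if h : ∃ y, IsCondExp N x y then h.choose else 0

end Deformation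

end CocycleDeformation

namespace CocycleDeformation

open MeasureTheory ProbabilityTheory Complex
open scoped ENNReal NNReal

set_option linter.unusedSectionVars false

/-! ### Operators in the commutant of a crossed product -/

section Crossed

variable {Γ K : Type*} [Group Γ] [NormedAddCommGroup K] [InnerProductSpace ℂ K] [CompleteSpace K]

/-! Write Ω for `vacuum`, V for `deformationUnitary` at time t, and η = x*Ω. The cocycle identity
gives b(1) = 0, so V fixes Ω. Since α_t(x) = VxV*, it follows that α_t(x)*Ω = Vη. Hence τ(α_t(x)y*)
= ⟨Vη, y*Ω⟩ for every y in M.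

For x and y in M, all coordinates of η and y*Ω lie in 1 ⊗ L²(X). The operator V multiplies the g-th
coordinate by ω(-t b(g⁻¹)), and only the Gaussian mean exp(-t²‖b(g⁻¹)‖²) of this function survives
in the inner product. So τ(α_t(x)y*) = ⟨Tη, y*Ω⟩, where T is the diagonal operator `damping`, and 0
≤ T ≤ 1 (`tau_deformation_mul_star`).

For y = x this is ⟨Tη, η⟩, which is real. For y = E_M(α_t(x)) it equals τ(yy*) = ‖y*Ω‖², so
Cauchy–Schwarz gives ‖y*Ω‖ ≤ ‖Tη‖. The trace property on M turns ‖y*Ω‖ into ‖y‖₂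
(`norm_star_apply_vacuum`). The theorem is then ‖Tη‖² ≤ ⟨Tη, η⟩, that is, T² ≤ T
(`norm_damping_sq_le`).

Both facts about M used here, the location of xΩ and the trace property, come from commutant
elements of M applied to Ω: `constOp` and `rightTranslation`. -/

theorem star_translation (h : Γ) :
    star (translation h : lp (fun _ : Γ => K) 2 →L[ℂ] lp (fun _ : Γ => K) 2) =
      translation h⁻¹ := by
  rw [ContinuousLinearMap.star_eq_adjoint, eq_comm, ContinuousLinearMap.eq_adjoint_iff]
  intro f f'
  rw [lp.inner_eq_tsum, lp.inner_eq_tsum, ← (Equiv.mulLeft h⁻¹).tsum_eq]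
  simp

/-- The unitary `(ρ_h f)(g) = U_h f(g h)` on `ℓ²(Γ, K)`, which commutes with the crossed products
by the action `Ad U`. -/
noncomputable def rightTranslation (U : Γ →* (K ≃ₗᵢ[ℂ] K)) (h : Γ) :
    lp (fun _ : Γ => K) 2 →L[ℂ] lp (fun _ : Γ => K) 2 :=
  LinearMap.mkContinuous
    { toFun := fun f => ⟨fun g => U h (f (g * h)), memℓp_gen (by
        simp only [LinearIsometryEquiv.norm_map]
        exact ((Equiv.mulRight h).summable_iff).2 ((lp.memℓp f).summable (by norm_num)))⟩
      map_add' := fun f f' => by ext g; simp; rfl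
      map_smul' := fun c f => by ext g; simp }
    1 fun f => by
      refine lp.norm_le_of_tsum_le (by norm_num) (by positivity) ?_
      rw [one_mul, lp.norm_rpow_eq_tsum (by norm_num)]
      refine le_of_eq (Eq.trans ?_
        ((Equiv.mulRight h).tsum_eq fun g => ‖f g‖ ^ (2 : ℝ≥0∞).toReal))
      refine tsum_congr fun g => ?_
      exact congrArg (· ^ (2 : ℝ≥0∞).toReal) ((U h).norm_map _)

@[simp] theorem rightTranslation_apply (U : Γ →* (K ≃ₗᵢ[ℂ] K)) (h : Γ)
    (f : lp (fun _ : Γ => K) 2) (g : Γ) : rightTranslation U h f g = U h (f (g * h)) := rfl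

theorem star_crossedEmb (U : Γ →* (K ≃ₗᵢ[ℂ] K)) (x : K →L[ℂ] K) :
    star (crossedEmb U x) = crossedEmb U (star x) := by
  rw [crossedEmb, star_diagOp]
  ext1 f
  ext1
  funext g
  simp only [crossedEmb, diagOp_apply, map_star]

/-- The shift reads off the coordinate gh, where x acts as σ of (gh)⁻¹. Conjugation by U_h brings
this back to the action at g, because h(gh)⁻¹ = g⁻¹. -/
theorem crossedEmb_mul_rightTranslation (U : Γ →* (K ≃ₗᵢ[ℂ] K)) (x : K →L[ℂ] K) (h : Γ) :
    crossedEmb U x * rightTranslation U h = rightTranslation U h * crossedEmb U x := by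
  ext1 f
  ext1
  funext g
  have hU : ∀ (g k : Γ) (v : K), U (g * k) v = U g (U k v) := fun g k v => by rw [map_mul]; rfl
  have hs : ∀ (g : Γ) (v : K), (U g⁻¹).symm v = U g v := fun g v => by
    rw [LinearIsometryEquiv.symm_apply_eq, ← hU, inv_mul_cancel, map_one]; rfl
  change (U g⁻¹).conjStarAlgEquiv x (U h (f (g * h))) =
    U h ((U (g * h)⁻¹).conjStarAlgEquiv x (f (g * h)))
  rw [LinearIsometryEquiv.conjStarAlgEquiv_apply_apply,
    LinearIsometryEquiv.conjStarAlgEquiv_apply_apply, hs, hs, ← hU, ← hU]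
  congr 2
  group

/-- It suffices to check generators, and left translations of Γ commute with right ones. Applied to
Ω, these operators reach the vectors 1 ⊗ δ_g. -/
theorem rightTranslation_comm {N : VonNeumannAlgebra K} {U : Γ →* (K ≃ₗᵢ[ℂ] K)} (h : Γ)
    {x : lp (fun _ : Γ => K) 2 →L[ℂ] lp (fun _ : Γ => K) 2} (hx : x ∈ crossedProduct N U) :
    rightTranslation U h * x = x * rightTranslation U h := by
  have ht : ∀ k : Γ, translation k * rightTranslation U h = rightTranslation U h * translation k :=
    fun k => by
      ext1 f
      ext1
      funext g
      simp [mul_assoc]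
  refine mem_generatedVN.1 hx _ ?_
  rintro s (⟨y, -, rfl⟩ | ⟨k, rfl⟩)
  · exact ⟨crossedEmb_mul_rightTranslation U y h, by
      rw [star_crossedEmb]; exact crossedEmb_mul_rightTranslation U _ h⟩
  · exact ⟨ht k, by rw [star_translation]; exact ht _⟩

/-- The operator `1 ⊗ T` on `ℓ²(Γ, K)`. -/
noncomputable def constOp (Γ : Type*) (T : K →L[ℂ] K) :
    lp (fun _ : Γ => K) 2 →L[ℂ] lp (fun _ : Γ => K) 2 :=
  diagOp (fun _ => T) ‖T‖₊ fun _ => le_rfl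

/-- An operator that commutes with `σ_g(x)` for all `g ∈ Γ` and all generators `x` of `N` gives
an element of the commutant of `N ⋊ Γ`. -/
theorem constOp_comm {S : Set (K →L[ℂ] K)} {U : Γ →* (K ≃ₗᵢ[ℂ] K)} {T : K →L[ℂ] K}
    (hU : ∀ g, ∀ s ∈ S, (U g).conjStarAlgEquiv s ∈ generatedVN S)
    (hT : ∀ s ∈ S, s * T = T * s ∧ star s * T = T * star s)
    {x : lp (fun _ : Γ => K) 2 →L[ℂ] lp (fun _ : Γ => K) 2}
    (hx : x ∈ crossedProduct (generatedVN S) U) : constOp Γ T * x = x * constOp Γ T := by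
  have ht : ∀ k : Γ, translation k * constOp Γ T = constOp Γ T * translation k := fun k => rfl
  have hc : ∀ y ∈ generatedVN S, crossedEmb U y * constOp Γ T = constOp Γ T * crossedEmb U y :=
    fun y hy => diagOp_comm _ _ fun g =>
      (mem_generatedVN.1 (conjStarAlgEquiv_mem_generatedVN (hU g⁻¹) hy) T hT).symm
  refine mem_generatedVN.1 hx _ ?_
  rintro s (⟨y, hy, rfl⟩ | ⟨k, rfl⟩)
  · exact ⟨hc y hy, by rw [star_crossedEmb]; exact hc _ (star_mem hy)⟩
  · exact ⟨ht k, by rw [star_translation]; exact ht _⟩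

end Crossed

/-! ### The subspace 1 ⊗ L²(X) of L²(Z × X) and the Gaussian mean -/

section Embedding

variable {X ι H : Type*} [MeasurableSpace X] (μ : Measure X) [IsProbabilityMeasure μ]
  [NormedAddCommGroup H] [InnerProductSpace ℝ H]

variable (ι) in
/-- The isometry `f ↦ 1 ⊗ f` from `L²(X)` to `L²(Z × X)`. -/
noncomputable def sndEmb : Lp ℂ 2 μ →ₗᵢ[ℂ] Lp ℂ 2 ((gaussMeasure ι).prod μ) :=
  Lp.compMeasurePreservingₗᵢ ℂ Prod.snd measurePreserving_snd

theorem sndEmb_ae (f : Lp ℂ 2 μ) :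
    sndEmb ι μ f =ᵐ[(gaussMeasure ι).prod μ] fun p => f p.2 :=
  Lp.coeFn_compMeasurePreserving f measurePreserving_snd

variable (ι) in
/-- The orthogonal projection of `L²(Z × X)` onto `1 ⊗ L²(X)`. -/
noncomputable def sndProj :
    Lp ℂ 2 ((gaussMeasure ι).prod μ) →L[ℂ] Lp ℂ 2 ((gaussMeasure ι).prod μ) :=
  (sndEmb ι μ).toContinuousLinearMap ∘L
    ContinuousLinearMap.adjoint (sndEmb ι μ).toContinuousLinearMap

theorem sndProj_sndEmb (f : Lp ℂ 2 μ) : sndProj ι μ (sndEmb ι μ f) = sndEmb ι μ f := by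
  change sndEmb ι μ (ContinuousLinearMap.adjoint (sndEmb ι μ).toContinuousLinearMap
    ((sndEmb ι μ).toContinuousLinearMap f)) = _
  congr 1
  refine ext_inner_right ℂ fun v => ?_
  rw [ContinuousLinearMap.adjoint_inner_left]
  exact (sndEmb ι μ).inner_map_map f v

theorem star_liftX (a : Lp ℂ ∞ μ) : star (liftX ι μ a) = liftX ι μ (star a) := by
  apply Lp.ext
  have hs := measurePreserving_snd (μ := gaussMeasure ι) (ν := μ)
  filter_upwards [Lp.coeFn_star (liftX ι μ a), Lp.coeFn_compMeasurePreserving a hs,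
    Lp.coeFn_compMeasurePreserving (star a) hs,
    hs.quasiMeasurePreserving.ae_eq_comp (Lp.coeFn_star a)] with p h1 h2 h3 h4
  rw [h1, liftX, liftX, Pi.star_apply, h2, h3, h4]
  rfl

theorem mulOp_liftX_sndEmb (a : Lp ℂ ∞ μ) (f : Lp ℂ 2 μ) :
    mulOp (liftX ι μ a) (sndEmb ι μ f) = sndEmb ι μ (mulOp a f) := by
  apply Lp.ext
  have hs := measurePreserving_snd (μ := gaussMeasure ι) (ν := μ)
  filter_upwards [mulOp_ae (liftX ι μ a) (sndEmb ι μ f), Lp.coeFn_compMeasurePreserving a hs,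
    sndEmb_ae (ι := ι) μ f, sndEmb_ae (ι := ι) μ (mulOp a f),
    hs.quasiMeasurePreserving.ae_eq_comp (mulOp_ae a f)] with p h1 h2 h3 h4 h5
  have h5' : mulOp a f p.2 = a p.2 * f p.2 := h5
  rw [h1, h4, h5', h3, liftX, h2]
  rfl

/-- With J = `sndEmb`, the projection is JJ*. Multiplication by a passes through J, and through J*
by taking adjoints. -/
theorem mulOp_liftX_mul_sndProj (a : Lp ℂ ∞ μ) :
    mulOp (liftX ι μ a) * sndProj ι μ = sndProj ι μ * mulOp (liftX ι μ a) := by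
  have key : ∀ a : Lp ℂ ∞ μ,
      mulOp (liftX ι μ a) ∘L (sndEmb ι μ).toContinuousLinearMap =
        (sndEmb ι μ).toContinuousLinearMap ∘L mulOp a :=
    fun a => ContinuousLinearMap.ext fun f => mulOp_liftX_sndEmb μ a f
  -- The relation is used for the conjugate of a, so that its adjoint speaks of a itself.
  have key' := congrArg ContinuousLinearMap.adjoint (key (star a))
  rw [ContinuousLinearMap.adjoint_comp, ContinuousLinearMap.adjoint_comp,
    ← ContinuousLinearMap.star_eq_adjoint (mulOp _), ← ContinuousLinearMap.star_eq_adjoint (mulOp _),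
    star_mulOp, star_mulOp, star_liftX, star_star] at key'
  change mulOp (liftX ι μ a) ∘L (_ ∘L _) = (_ ∘L _) ∘L mulOp (liftX ι μ a)
  rw [← ContinuousLinearMap.comp_assoc, key, ContinuousLinearMap.comp_assoc,
    ContinuousLinearMap.comp_assoc, key']

/-- By Fubini the inner product splits into the integral of ω(ξ) over Z and an inner product over X.
The first factor is a value of the Gaussian characteristic function. -/
theorem inner_omegaOp_sndEmb [Countable ι] (e : HilbertBasis ι ℝ H) (ξ : H) (f f' : Lp ℂ 2 μ) :
    inner ℂ (omegaOp μ e ξ (sndEmb ι μ f)) (sndEmb ι μ f') =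
      (Real.exp (-‖ξ‖ ^ 2) : ℂ) * inner ℂ f f' := by
  have h1 : ∫ z, star (omegaFun e ξ z) ∂(gaussMeasure ι) = (Real.exp (-‖ξ‖ ^ 2) : ℂ) := by
    -- The sign comes from the conjugation in the first slot of the inner product. The √2 in the
    -- definition of ω cancels the 1/2 in the Gaussian exponent.
    have h := integral_exp_gaussField e (-(Real.sqrt 2 • ξ))
    rw [norm_neg, norm_smul, mul_pow, Real.norm_eq_abs, sq_abs, Real.sq_sqrt (by norm_num)] at h
    rw [show -‖ξ‖ ^ 2 = -(2 * ‖ξ‖ ^ 2) / 2 by ring, ← h]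
    refine integral_congr_ae ?_
    rw [map_neg, map_smul]
    filter_upwards [Lp.coeFn_neg (Real.sqrt 2 • gaussField e ξ),
      Lp.coeFn_smul (Real.sqrt 2) (gaussField e ξ)] with z h2 h3
    rw [h2, Pi.neg_apply, h3, Pi.smul_apply, omegaFun, star_def, ← exp_conj]
    congr 1
    simp
    ring
  rw [L2.inner_def, L2.inner_def, ← h1, ← integral_prod_mul]
  refine integral_congr_ae ?_
  filter_upwards [omegaOp_ae μ e ξ (sndEmb ι μ f), sndEmb_ae (ι := ι) μ f,
    sndEmb_ae (ι := ι) μ f'] with p h2 h3 h4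
  rw [h2, h3, h4]
  simp
  ring

end Embedding

/-! ### The vectors xΩ for x in M, and the trace property -/

section Deformation

theorem norm_star_Lp {Y : Type*} [MeasurableSpace Y] {m : Measure Y} {p : ℝ≥0∞} (f : Lp ℂ p m) :
    ‖star f‖ = ‖f‖ := by
  rw [Lp.norm_def, Lp.norm_def]
  congr 1
  refine eLpNorm_congr_norm_ae ?_
  filter_upwards [Lp.coeFn_star f] with y hy
  rw [hy, Pi.star_apply, norm_star]

variable {Γ X ι H : Type*} [Group Γ] [MeasurableSpace X] [MulAction Γ X] [MeasurableConstSMul Γ X]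
  {μ : Measure X} [IsProbabilityMeasure μ] [SMulInvariantMeasure Γ X μ]
  [Countable ι] [NormedAddCommGroup H] [InnerProductSpace ℝ H]
  {e : HilbertBasis ι ℝ H} {π : Γ →* (H ≃ₗᵢ[ℝ] H)} {b : Γ → H}
  {x y : HilbertK Γ ι μ →L[ℂ] HilbertK Γ ι μ}

/-- Adjoints of the generators need no separate hypothesis, since A is closed under conjugation.
This serves for T = `sndProj` and for multiplication by an arbitrary bounded function on Z × X. -/
theorem constOp_comm_of_mem_Msub
    {T : Lp ℂ 2 ((gaussMeasure ι).prod μ) →L[ℂ] Lp ℂ 2 ((gaussMeasure ι).prod μ)}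
    (hT : ∀ a, mulOp (liftX ι μ a) * T = T * mulOp (liftX ι μ a)) (hx : x ∈ Msub μ e π) :
    constOp Γ T * x = x * constOp Γ T := by
  refine constOp_comm ?_ ?_ hx
  · rintro g _ ⟨a, rfl⟩
    change (diagonalRep μ e π g).conjStarAlgEquiv (mulOp (liftX ι μ a)) ∈ _
    rw [conj_liftX]
    exact subset_generatedVN _ ⟨_, rfl⟩
  · rintro _ ⟨a, rfl⟩
    refine ⟨hT a, ?_⟩
    change star (mulOp (liftX ι μ a)) * T = T * star (mulOp (liftX ι μ a))
    rw [star_mulOp, star_liftX]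
    exact hT _

theorem vacuum_one : vacuum Γ ι μ 1 = Lp.const 2 ((gaussMeasure ι).prod μ) (1 : ℂ) := by
  classical
  simp [vacuum]

theorem vacuum_ne {g : Γ} (hg : g ≠ 1) : vacuum Γ ι μ g = 0 := by
  classical
  simp [vacuum, hg]

theorem inner_vacuum_right (f : HilbertK Γ ι μ) :
    inner ℂ f (vacuum Γ ι μ) = inner ℂ (f 1) (Lp.const 2 ((gaussMeasure ι).prod μ) (1 : ℂ)) := by
  rw [lp.inner_eq_tsum, tsum_eq_single 1 fun g hg => by rw [vacuum_ne hg, inner_zero_right],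
    vacuum_one]

theorem const_eq_sndEmb : Lp.const 2 ((gaussMeasure ι).prod μ) (1 : ℂ) =
    sndEmb ι μ (Lp.const 2 μ (1 : ℂ)) := by
  apply Lp.ext
  filter_upwards [Lp.coeFn_const (p := 2) ((gaussMeasure ι).prod μ) (1 : ℂ),
    sndEmb_ae (ι := ι) μ (Lp.const 2 μ (1 : ℂ)),
    Measure.quasiMeasurePreserving_snd.ae (Lp.coeFn_const (p := 2) μ (1 : ℂ))] with p h1 h2 h3
  rw [h1, h2, h3]
  rfl

/-- The vector `x (1 ⊗ δ_e)` lies in `ℓ²(Γ, 1 ⊗ L²(X))` for `x ∈ M`. -/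
theorem exists_sndEmb_of_mem_Msub (hx : x ∈ Msub μ e π) (g : Γ) :
    ∃ f, x (vacuum Γ ι μ) g = sndEmb ι μ f := by
  have h := constOp_comm_of_mem_Msub (mulOp_liftX_mul_sndProj (ι := ι) μ) hx
  have hv : constOp Γ (sndProj ι μ) (vacuum Γ ι μ) = vacuum Γ ι μ := by
    ext1
    funext k
    change sndProj ι μ (vacuum Γ ι μ k) = vacuum Γ ι μ k
    by_cases hk : k = 1
    · rw [hk, vacuum_one, const_eq_sndEmb, sndProj_sndEmb]
    · rw [vacuum_ne hk, map_zero]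
  -- The projection commutes with x and fixes Ω, so it fixes xΩ; every coordinate of xΩ is then in
  -- its range.
  have h2 : constOp Γ (sndProj ι μ) (x (vacuum Γ ι μ)) = x (vacuum Γ ι μ) :=
    (DFunLike.congr_fun h (vacuum Γ ι μ)).trans (congrArg x hv)
  refine ⟨ContinuousLinearMap.adjoint (sndEmb ι μ).toContinuousLinearMap
    (x (vacuum Γ ι μ) g), ?_⟩
  conv_lhs => rw [← h2]
  rfl

theorem diagonalRep_const (g : Γ) :
    diagonalRep μ e π g (Lp.const 2 ((gaussMeasure ι).prod μ) (1 : ℂ)) =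
      Lp.const 2 ((gaussMeasure ι).prod μ) (1 : ℂ) := by
  have hS := measurePreserving_diagonalMap μ e π g
  apply Lp.ext
  change Lp.compMeasurePreserving (diagonalMap e π g) hS _ =ᵐ[_] _
  have hc := Lp.coeFn_const (p := 2) ((gaussMeasure ι).prod μ) (1 : ℂ)
  filter_upwards [Lp.coeFn_compMeasurePreserving
      (Lp.const 2 ((gaussMeasure ι).prod μ) (1 : ℂ)) hS,
    hS.quasiMeasurePreserving.ae_eq_comp hc, hc] with p h1 h2 h3
  rw [h1, h2, h3]
  rfl

/-- `x* (1 ⊗ δ_e)` in terms of `x (1 ⊗ δ_e)`. -/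
theorem star_apply_vacuum (hx : x ∈ Msub μ e π) (g : Γ) :
    star x (vacuum Γ ι μ) g = star (diagonalRep μ e π g⁻¹ (x (vacuum Γ ι μ) g⁻¹)) := by
  classical
  set m := (gaussMeasure ι).prod μ
  -- Two L² functions agree once their integrals over all measurable sets s do. Indicators are
  -- bounded, so they are at once vectors and multiplication operators.
  refine Lp.ext (Lp.ae_eq_of_forall_setIntegral_eq _ _ (by norm_num) (by norm_num)
    (fun s _ _ => ((Lp.memLp _).integrable (by norm_num)).integrableOn)
    (fun s _ _ => ((Lp.memLp _).integrable (by norm_num)).integrableOn) fun s hs hms => ?_)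
  set φ : Lp ℂ ∞ m := indicatorConstLp ∞ hs hms.ne (1 : ℂ)
  set v := diagonalRep μ e π g⁻¹ (x (vacuum Γ ι μ) g⁻¹)
  have hφ : φ =ᵐ[m] s.indicator fun _ => (1 : ℂ) := indicatorConstLp_coeFn
  have h1 := DFunLike.congr_fun (constOp_comm_of_mem_Msub (fun a => mulOp_comm _ φ) hx)
    (rightTranslation (diagonalRep μ e π) g⁻¹ (vacuum Γ ι μ))
  have h2 := DFunLike.congr_fun (rightTranslation_comm g⁻¹ hx) (vacuum Γ ι μ)
  -- The vector 1_s ⊗ δ_g arises from Ω by commutant operators only, so x applied to it is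
  -- determined by xΩ.
  have h3 : constOp Γ (mulOp φ) (rightTranslation (diagonalRep μ e π) g⁻¹ (vacuum Γ ι μ)) =
      lp.single 2 g (indicatorConstLp 2 hs hms.ne (1 : ℂ)) := by
    ext1
    funext k
    change mulOp φ (diagonalRep μ e π g⁻¹ (vacuum Γ ι μ (k * g⁻¹))) = _
    by_cases hk : k = g
    · subst hk
      rw [mul_inv_cancel, vacuum_one, diagonalRep_const, lp.single_apply_self]
      apply Lp.ext
      filter_upwards [mulOp_ae φ (Lp.const 2 m (1 : ℂ)), hφ,
        indicatorConstLp_coeFn (p := 2) (hs := hs) (hμs := hms.ne) (c := (1 : ℂ)),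
        Lp.coeFn_const (p := 2) m (1 : ℂ)] with p e1 e2 e3 e4
      rw [e1, e2, e3, e4]
      simp
    · rw [vacuum_ne (by rwa [Ne, mul_inv_eq_one]), map_zero, map_zero, lp.single_apply_ne _ _ _ hk]
  have h4 : x (lp.single 2 g (indicatorConstLp 2 hs hms.ne (1 : ℂ))) 1 = mulOp φ v := by
    rw [← h3]
    refine (congrArg (fun f : HilbertK Γ ι μ => f 1) h1.symm).trans ?_
    change mulOp φ ((x * rightTranslation (diagonalRep μ e π) g⁻¹) (vacuum Γ ι μ) 1) = _
    rw [← h2]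
    change mulOp φ (diagonalRep μ e π g⁻¹ (x (vacuum Γ ι μ) (1 * g⁻¹))) = _
    rw [one_mul]
  have h5 : inner ℂ (indicatorConstLp 2 hs hms.ne (1 : ℂ)) (star x (vacuum Γ ι μ) g) =
      inner ℂ (lp.single 2 g (indicatorConstLp 2 hs hms.ne (1 : ℂ))) (star x (vacuum Γ ι μ)) :=
    (lp.inner_single_left (𝕜 := ℂ) (G := fun _ : Γ => Lp ℂ 2 m) g _ _).symm
  -- The integral of x*Ω at g over s is ⟨1_s ⊗ δ_g, x*Ω⟩ = ⟨x(1_s ⊗ δ_g), Ω⟩, which only involves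
  -- the coordinate at 1 computed in `h4`.
  rw [← L2.inner_indicatorConstLp_one hs hms.ne, h5, ContinuousLinearMap.star_eq_adjoint,
    ContinuousLinearMap.adjoint_inner_right, inner_vacuum_right, h4, L2.inner_def, ← integral_indicator hs]
  refine integral_congr_ae ?_
  filter_upwards [mulOp_ae φ v, hφ, Lp.coeFn_const (p := 2) m (1 : ℂ), Lp.coeFn_star v]
    with p e1 e2 e3 e4
  rw [e1, e2, e3, Set.indicator_apply, Set.indicator_apply, e4]
  split_ifs <;> simp

/-- `‖x*‖₂ = ‖x‖₂` for `x ∈ M`. -/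
theorem norm_star_apply_vacuum (hx : x ∈ Msub μ e π) :
    ‖star x (vacuum Γ ι μ)‖ = ‖x (vacuum Γ ι μ)‖ := by
  have h : ‖star x (vacuum Γ ι μ)‖ ^ (2 : ℝ≥0∞).toReal =
      ‖x (vacuum Γ ι μ)‖ ^ (2 : ℝ≥0∞).toReal := by
    -- The coordinate of x*Ω at g comes from that of xΩ at g⁻¹ by a unitary and a conjugation, so
    -- the two sums of squares agree after inverting the index.
    rw [lp.norm_rpow_eq_tsum (by norm_num), lp.norm_rpow_eq_tsum (by norm_num),
      ← (Equiv.inv Γ).tsum_eq]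
    refine tsum_congr fun g => ?_
    rw [Equiv.inv_apply, star_apply_vacuum hx, inv_inv]
    exact congrArg (· ^ (2 : ℝ≥0∞).toReal)
      ((norm_star_Lp _).trans (LinearIsometryEquiv.norm_map _ _))
  simpa using h

theorem tau_mul_star (z : HilbertK Γ ι μ →L[ℂ] HilbertK Γ ι μ) :
    tau (z * star y) = inner ℂ (star z (vacuum Γ ι μ)) (star y (vacuum Γ ι μ)) := by
  rw [ContinuousLinearMap.star_eq_adjoint z, ContinuousLinearMap.adjoint_inner_left]
  rfl

theorem twoNorm_eq (y : HilbertK Γ ι μ →L[ℂ] HilbertK Γ ι μ) :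
    twoNorm y = ‖y (vacuum Γ ι μ)‖ := by
  have h := tau_mul_star (y := star y) (star y)
  rw [star_star] at h
  rw [twoNorm, h, ← RCLike.re_eq_complex_re, inner_self_eq_norm_sq, Real.sqrt_sq (norm_nonneg _)]

/-- Ω is supported at the identity, where the unitary acts by ω(-t b(1)), and the cocycle identity
forces b(1) = 0. -/
theorem deformationUnitary_vacuum (hb : IsOneCocycle π b) (t : ℝ) :
    deformationUnitary μ e b t (vacuum Γ ι μ) = vacuum Γ ι μ := by
  have h1 : b 1 = 0 := by
    have h := hb 1 1
    rw [mul_one, map_one] at h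
    exact left_eq_add.1 h
  ext1
  funext g
  change omegaOp μ e (-(t • b g⁻¹)) (vacuum Γ ι μ g) = vacuum Γ ι μ g
  by_cases hg : g = 1
  · rw [hg, inv_one, h1, smul_zero, neg_zero, omegaOp_zero]
    rfl
  · rw [vacuum_ne hg, map_zero]

/-! ### The damping operator and the two estimates -/

/-- `M ∋ u_g ↦ exp(-t² ‖b(g)‖²) u_g`, on the level of vectors of `ℓ²(Γ, L²(Z × X))`. -/
noncomputable def damping (μ : Measure X) (ι : Type*) (b : Γ → H) (t : ℝ) :
    HilbertK Γ ι μ →L[ℂ] HilbertK Γ ι μ :=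
  diagOp (fun g => (Real.exp (-‖t • b g⁻¹‖ ^ 2) : ℂ) • 1) 1 fun g => by
    refine (norm_smul_le _ _).trans (mul_le_one₀ ?_ (norm_nonneg _)
      ContinuousLinearMap.norm_id_le)
    rw [norm_real, Real.norm_eq_abs, abs_of_pos (Real.exp_pos _), Real.exp_le_one_iff]
    exact neg_nonpos.2 (sq_nonneg _)

theorem damping_apply (t : ℝ) (f : HilbertK Γ ι μ) (g : Γ) :
    damping μ ι b t f g = (Real.exp (-‖t • b g⁻¹‖ ^ 2) : ℂ) • f g := rfl

theorem inner_damping_self_eq (t : ℝ) (f : HilbertK Γ ι μ) :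
    inner ℂ (damping μ ι b t f) f =
      ((∑' g, Real.exp (-‖t • b g⁻¹‖ ^ 2) * ‖f g‖ ^ 2 : ℝ) : ℂ) := by
  rw [lp.inner_eq_tsum, ofReal_tsum]
  refine tsum_congr fun g => ?_
  rw [damping_apply, inner_smul_left, conj_ofReal, inner_self_eq_norm_sq_to_K]
  push_cast
  rfl

/-- The weights c lie in (0, 1], hence c² ≤ c in each coordinate. This is the inequality T² ≤ T
behind the theorem. -/
theorem norm_damping_sq_le (t : ℝ) (f : HilbertK Γ ι μ) :
    ‖damping μ ι b t f‖ ^ 2 ≤ (inner ℂ (damping μ ι b t f) f).re := by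
  have hs : Summable fun g => ‖f g‖ ^ 2 := by
    simpa using (lp.memℓp f).summable (by norm_num)
  have h1 : ∀ g, Real.exp (-‖t • b g⁻¹‖ ^ 2) ≤ 1 := fun g =>
    Real.exp_le_one_iff.2 (neg_nonpos.2 (sq_nonneg _))
  have hs1 : Summable fun g => Real.exp (-‖t • b g⁻¹‖ ^ 2) * ‖f g‖ ^ 2 :=
    hs.of_nonneg_of_le (fun g => by positivity)
      fun g => mul_le_of_le_one_left (sq_nonneg _) (h1 g)
  have hle : ∀ g, ‖damping μ ι b t f g‖ ^ 2 ≤ Real.exp (-‖t • b g⁻¹‖ ^ 2) * ‖f g‖ ^ 2 := fun g => by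
    rw [damping_apply, norm_smul, mul_pow, norm_real, Real.norm_eq_abs,
      abs_of_pos (Real.exp_pos _)]
    exact mul_le_mul_of_nonneg_right (pow_le_of_le_one (Real.exp_pos _).le (h1 g) two_ne_zero)
      (sq_nonneg _)
  have hn := lp.norm_rpow_eq_tsum (p := 2) (by norm_num) (damping μ ι b t f)
  simp only [ENNReal.toReal_ofNat, Real.rpow_ofNat] at hn
  rw [inner_damping_self_eq, ofReal_re, hn]
  exact (hs1.of_nonneg_of_le (fun g => sq_nonneg _) hle).tsum_le_tsum hle hs1

/-- On vectors from M, the unitary implementing α_t can be replaced by its compression to ℓ²(Γ, 1 ⊗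
L²(X)), which is the damping operator. -/
theorem tau_deformation_mul_star (hb : IsOneCocycle π b) (t : ℝ)
    (x : (Mtilde μ e π).toStarSubalgebra)
    (hx : (x : HilbertK Γ ι μ →L[ℂ] HilbertK Γ ι μ) ∈ Msub μ e π)
    (hy : y ∈ Msub μ e π) :
    tau ((deformation μ e π hb t x : HilbertK Γ ι μ →L[ℂ] HilbertK Γ ι μ) * star y) =
      inner ℂ (damping μ ι b t (star (x : HilbertK Γ ι μ →L[ℂ] HilbertK Γ ι μ) (vacuum Γ ι μ)))
        (star y (vacuum Γ ι μ)) := by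
  set x' : HilbertK Γ ι μ →L[ℂ] HilbertK Γ ι μ := (x : HilbertK Γ ι μ →L[ℂ] HilbertK Γ ι μ)
  have h1 : star (deformation μ e π hb t x : HilbertK Γ ι μ →L[ℂ] HilbertK Γ ι μ) (vacuum Γ ι μ) =
      deformationUnitary μ e b t (star x' (vacuum Γ ι μ)) := by
    change star (deformationUnitary μ e b t * x' * star (deformationUnitary μ e b t)) _ = _
    rw [star_mul, star_mul, star_star, star_deformationUnitary]
    change deformationUnitary μ e b t (star x' (deformationUnitary μ e b (-t) _)) = _
    rw [deformationUnitary_vacuum hb]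
  rw [tau_mul_star, h1, lp.inner_eq_tsum, lp.inner_eq_tsum]
  refine tsum_congr fun g => ?_
  -- Both coordinates are constant in the Gaussian variable, so ω(-t b(g⁻¹)) contributes only its
  -- mean.
  obtain ⟨f, hf⟩ := exists_sndEmb_of_mem_Msub (star_mem hx) g
  obtain ⟨f', hf'⟩ := exists_sndEmb_of_mem_Msub (star_mem hy) g
  change inner ℂ (omegaOp μ e (-(t • b g⁻¹)) (star x' (vacuum Γ ι μ) g)) _ = _
  rw [damping_apply, hf, hf', inner_omegaOp_sndEmb, inner_smul_left, conj_ofReal, norm_neg]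
  congr 1
  exact ((sndEmb ι μ).inner_map_map f f').symm

/-- Testing the defining property of y against z = y* gives ‖y*Ω‖² = ⟨Tη, y*Ω⟩; Cauchy–Schwarz and
the trace property finish. -/
theorem twoNorm_le_of_isCondExp (hb : IsOneCocycle π b) (t : ℝ)
    (x : (Mtilde μ e π).toStarSubalgebra)
    (hx : (x : HilbertK Γ ι μ →L[ℂ] HilbertK Γ ι μ) ∈ Msub μ e π)
    (hy : IsCondExp (Msub μ e π) (deformation μ e π hb t x) y) :
    twoNorm y ≤
      ‖damping μ ι b t (star (x : HilbertK Γ ι μ →L[ℂ] HilbertK Γ ι μ) (vacuum Γ ι μ))‖ := by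
  have h := hy.2 (star y) (star_mem hy.1)
  rw [tau_deformation_mul_star hb t x hx hy.1, tau_mul_star] at h
  rw [twoNorm_eq, ← norm_star_apply_vacuum hy.1]
  set η := star y (vacuum Γ ι μ)
  have h2 : ‖η‖ * ‖η‖ ≤
      ‖damping μ ι b t (star (x : HilbertK Γ ι μ →L[ℂ] HilbertK Γ ι μ) (vacuum Γ ι μ))‖ * ‖η‖ := by
    rw [← inner_self_eq_norm_mul_norm (𝕜 := ℂ), h]
    exact (RCLike.re_le_norm _).trans (norm_inner_le_norm _ _)
  -- Cancelling a factor ‖y*Ω‖ requires it to be nonzero; otherwise the bound is trivial.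
  rcases (norm_nonneg η).eq_or_lt with h0 | h0
  · rw [← h0]; exact norm_nonneg _
  · exact le_of_mul_le_mul_right h2 h0

end Deformation

end CocycleDeformation

/-! ### The inequality -/

open MeasureTheory CocycleDeformation in
theorem lemma3p4 {Γ X ι H : Type*} [Group Γ]
    [MeasurableSpace X] [MulAction Γ X] [MeasurableConstSMul Γ X]
    (μ : Measure X) [IsProbabilityMeasure μ] [SMulInvariantMeasure Γ X μ]
    [Countable ι] [NormedAddCommGroup H] [InnerProductSpace ℝ H]
    (e : HilbertBasis ι ℝ H) (π : Γ →* (H ≃ₗᵢ[ℝ] H)) (b : Γ → H) (hb : IsOneCocycle π b)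
    (t : ℝ) (x : (Mtilde μ e π).toStarSubalgebra)
    (hx : (x : HilbertK Γ ι μ →L[ℂ] HilbertK Γ ι μ) ∈ Msub μ e π) :
    (tau ((deformation μ e π hb t x : HilbertK Γ ι μ →L[ℂ] HilbertK Γ ι μ) *
          star (x : HilbertK Γ ι μ →L[ℂ] HilbertK Γ ι μ))).im = 0 ∧
      twoNorm (condExp (Msub μ e π) (deformation μ e π hb t x)) ^ 2 ≤
        (tau ((deformation μ e π hb t x : HilbertK Γ ι μ →L[ℂ] HilbertK Γ ι μ) *
          star (x : HilbertK Γ ι μ →L[ℂ] HilbertK Γ ι μ))).re := by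
  have h := tau_deformation_mul_star hb t x hx hx
  have h0 := norm_damping_sq_le (b := b) t
    (star (x : HilbertK Γ ι μ →L[ℂ] HilbertK Γ ι μ) (vacuum Γ ι μ))
  rw [h]
  refine ⟨by rw [inner_damping_self_eq, Complex.ofReal_im], le_trans ?_ h0⟩
  refine pow_le_pow_left₀ (by rw [twoNorm_eq]; exact norm_nonneg _) ?_ 2
  rw [CocycleDeformation.condExp]
  -- Existence of the conditional expectation is not needed here: in the other branch `condExp` is
  -- 0, whose 2-norm satisfies the bound trivially.
  split_ifs with hy
  · exact twoNorm_le_of_isCondExp hb t x hx hy.choose_spec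
  · rw [twoNorm_eq]
    simp
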